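/- Let $D\ge 2$ be an integer and $p>1$ a real number. Call a nonempty, open, bounded, convex set $\Omega\subset\mathbb{R}^D$ a bounded convex domain, let $|\Omega|$ be its Lebesgue measure and let $R_\Omega$ be its inradius, that is, the supremum of the radii of the balls contained in $\Omega$. Let $u_p\in W_0^{1,p}(\Omega)$ be the $p$-torsion function of $\Omega$, i.e. the unique weak solution of $-\operatorname{div}(|\nabla u|^{p-2}\nabla u)=1$ in $\Omega$, $u=0$ on $\partial\Omega$, and set $$T_p(\Omega)=\int_\Omega u_p\,dx,\qquad T(p;\Omega)=|\Omega|^{p-1}\,T_p(\Omega)^{1-p},\qquad Q_p(\Omega)=\left(\frac{T(p;\Omega)\,R_\Omega^{\,p}}{\left(\frac{2p-1}{p-1}\right)^{p-1}}\right)^{1/p}.$$ Then $Q_p$ is bounded above on the family of all bounded convex domains in $\mathbb{R}^D$, and the number $$\gamma_{D,p}:=\frac{\inf_\Omega Q_p(\Omega)}{\sup_\Omega Q_p(\Omega)}$$ (infimum and supremum over all bounded convex domains $\Omega\subset\mathbb{R}^D$), which depends only on $D$ and $p$, satisfies $\frac1D\le\gamma_{D,p}<1$. Moreover, for all real numbers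 $0<a<b$: (i) the inequality $T(p;\Omega_b)\le T(p;\Omega_a)$ holds for all bounded convex domains $\Omega_a,\Omega_b\subset\mathbb{R}^D$ with $R_{\Omega_a}=a$ and $R_{\Omega_b}=b$ if and only if $\gamma_{D,p}\,b\ge a$; (ii) if $\gamma_{D,p}\,b>a$, then $T(p;\Omega_b)<T(p;\Omega_a)$ for all bounded convex domains $\Omega_a,\Omega_b\subset\mathbb{R}^D$ with $R_{\Omega_a}=a$ and $R_{\Omega_b}=b$; (iii) if $\gamma_{D,p}\,b=a$, then there are sequences $(\omega_n)_n$ and $(\Omega_n)_n$ of bounded convex domains in $\mathbb{R}^D$ with $R_{\omega_n}=a$ and $R_{\Omega_n}=b$ for all $n$ such that the limits $\lim_{n\to\infty}T(p;\Omega_n)$ and $\lim_{n\to\infty}T(p;\omega_n)$ exist, are finite and are equal. -/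

import Mathlib

open MeasureTheory Filter Topology
open scoped ContDiff

noncomputable section

namespace PTorsion

/-- The Euclidean space `ℝ^D`. -/
abbrev E (D : ℕ) : Type := EuclideanSpace ℝ (Fin D)

variable {D : ℕ}

/-! ### Convex domains and the inradius -/

/-- The family of all bounded convex domains (nonempty open sets) of `ℝ^D`. -/
def convexDomains (D : ℕ) : Set (Set (E D)) :=
  {Ω | Ω.Nonempty ∧ IsOpen Ω ∧ Bornology.IsBounded Ω ∧ Convex ℝ Ω}

/-- The inradius of `Ω`: the supremum of the radii of the balls contained in `Ω`. -/
def inradius (Ω : Set (E D)) : ℝ :=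
  sSup {r : ℝ | 0 ≤ r ∧ ∃ x : E D, Metric.ball x r ⊆ Ω}

/-- The family of all bounded convex domains of `ℝ^D` with inradius `r`. -/
def convexDomainsOfInradius (D : ℕ) (r : ℝ) : Set (Set (E D)) :=
  {Ω | Ω ∈ convexDomains D ∧ inradius Ω = r}

/-! ### The space `W₀^{1,p}(Ω)` -/

/-- `φ ∈ C_c^∞(Ω)`. -/
def IsTestFunction (Ω : Set (E D)) (φ : E D → ℝ) : Prop :=
  ContDiff ℝ ∞ φ ∧ HasCompactSupport φ ∧ tsupport φ ⊆ Ω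

/-- `g` is a weak gradient of `u` on `Ω` (for `u` and `g` integrable on `Ω`). -/
def IsWeakGradient (Ω : Set (E D)) (u : E D → ℝ) (g : E D → E D) : Prop :=
  ∀ φ : E D → ℝ, IsTestFunction Ω φ →
    ∫ x in Ω, u x • gradient φ x = - ∫ x in Ω, φ x • g x

/-- `u ∈ W^{1,p}(Ω)` with weak gradient `g`. Only the restrictions of `u` and `g` to `Ω`
matter. -/
def MemW (p : ℝ) (Ω : Set (E D)) (u : E D → ℝ) (g : E D → E D) : Prop :=
  MemLp u (ENNReal.ofReal p) (volume.restrict Ω) ∧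
  MemLp g (ENNReal.ofReal p) (volume.restrict Ω) ∧
  IsWeakGradient Ω u g

/-- `u ∈ W₀^{1,p}(Ω)` with weak gradient `g`: `u` lies in `W^{1,p}(Ω)` and is the limit in
`W^{1,p}(Ω)` of a sequence of functions in `C_c^∞(Ω)`. -/
def MemWZero (p : ℝ) (Ω : Set (E D)) (u : E D → ℝ) (g : E D → E D) : Prop :=
  MemW p Ω u g ∧
  ∃ φ : ℕ → E D → ℝ, (∀ n, IsTestFunction Ω (φ n)) ∧
    Tendsto (fun n => eLpNorm (fun x => φ n x - u x) (ENNReal.ofReal p) (volume.restrict Ω))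
      atTop (𝓝 0) ∧
    Tendsto (fun n => eLpNorm (fun x => gradient (φ n) x - g x) (ENNReal.ofReal p)
      (volume.restrict Ω)) atTop (𝓝 0)

/-! ### The `p`-torsion function and the `p`-torsional rigidity -/

/-- `u` is a `p`-torsion function on `Ω`: the weak solution in `W₀^{1,p}(Ω)` of
`-div(|∇u|^{p-2} ∇u) = 1` in `Ω`, `u = 0` on `∂Ω`. (Where the weak gradient vanishes, so does
the vector `|∇u|^{p-2} ∇u`, whatever the value of the real power.) -/
def IsTorsionFunction (p : ℝ) (Ω : Set (E D)) (u : E D → ℝ) : Prop :=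
  ∃ g : E D → E D, MemWZero p Ω u g ∧
    ∀ φ : E D → ℝ, IsTestFunction Ω φ →
      ∫ x in Ω, ‖g x‖ ^ (p - 2) * inner ℝ (g x) (gradient φ x) = ∫ x in Ω, φ x

open Classical in
/-- The `p`-torsional rigidity `T_p(Ω) = ∫_Ω u_p dx`, where `u_p` is the `p`-torsion function
(which exists and is unique almost everywhere on `Ω` for `p > 1` and every bounded convex
domain `Ω`; the value is set to `0` if there is none). -/
def torsionalRigidity (p : ℝ) (Ω : Set (E D)) : ℝ :=
  if h : ∃ u : E D → ℝ, IsTorsionFunction p Ω u then ∫ x in Ω, h.choose x else 0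

/-- The normalized `p`-torsional rigidity `T(p;Ω) = |Ω|^{p-1} T_p(Ω)^{1-p}`. -/
def normTorsion (p : ℝ) (Ω : Set (E D)) : ℝ :=
  (volume.real Ω) ^ (p - 1) * (torsionalRigidity p Ω) ^ (1 - p)

/-! ### The scale-invariant quantity and the comparison constant -/

/-- `Q_p(Ω) = (T(p;Ω) R_Ω^p / ((2p-1)/(p-1))^{p-1})^{1/p}`. -/
def Q (p : ℝ) (Ω : Set (E D)) : ℝ :=
  (normTorsion p Ω * inradius Ω ^ p / ((2 * p - 1) / (p - 1)) ^ (p - 1)) ^ (1 / p)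

/-- `γ_{D,p}`: the infimum of `Q_p` over all bounded convex domains of `ℝ^D` divided by its
supremum. -/
def gammaConst (D : ℕ) (p : ℝ) : ℝ :=
  sInf (Q p '' convexDomains D) / sSup (Q p '' convexDomains D)

end PTorsion

end

/-! Let `q` be the exponent conjugate to `p`, `R` the inradius, `T` the torsional rigidity and `W =
|Ω| D / (D + q)`. Then `Q` is a constant, depending only on `D` and `p`, times the scale-invariant
ratio `R W^(1/q) / T^(1 - 1/p)` (`torsionRatio`). The core of the proof is that this ratio lies in
`[1, D]`.

The direct method yields a torsion function, and `T^(1 - 1/p)` is identified with the best constant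
`K` in `∫ φ ≤ K ‖∇φ‖_p` over test functions (`integral_le_torsionalRigidity`,
`torsionalRigidity_rpow_le`). Bounding `T` from above then means proving such an inequality.
Bounding it from below means exhibiting one competitor, which by mollification may be merely
Lipschitz (`integral_le_of_lipschitz`).

Ratio at least `1`: the distance `d` to the complement of a convex set is concave with unit slope,
so `(R - d)² / 2` has Laplacian at least `1`. Testing this against `f ≥ 0` gives `∫ f ≤ ∫ |∇f| (R -
d)` (`integral_le_integral_fderiv_mul`). Hölder's inequality, `R - d ≤ R J` for the gauge `J` about
an incentre, and `∫ J^q = W` finish the bound.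

Ratio at most `D`: the competitor is `1 - J^q`, where `J` has slope at most `1/R`.

The unit ball reaches `D`, because the divergence theorem gives `D ∫ φ ≤ ∫ |∇φ| |x|`. A ball of
radius two cut by a slab has a gauge of slope at most `1/2` on an open set, so its ratio is strictly
below `D`. Hence `1/D ≤ inf Q / sup Q < 1`.

Dilations preserve the ratio, so every value of `Q` occurs at every inradius. Since `T(p;Ω)` is a
constant times `(Q / R)^p`, comparing all pairs of domains amounts to `sup Q * a ≤ inf Q * b`, and
the three claims follow. -/

set_option linter.unusedSectionVars false

noncomputable section

namespace PTorsion

/-! ### Quantitative strict convexity of `‖·‖ ^ p` -/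

section Convexity

variable {V : Type*} [NormedAddCommGroup V] [InnerProductSpace ℝ V]

/-- The convexity defect of `‖·‖ ^ p` at the pair `a`, `b`. -/
def defect (p : ℝ) (a b : V) : ℝ :=
  (‖a‖ ^ p + ‖b‖ ^ p) / 2 - ‖(1 / 2 : ℝ) • (a + b)‖ ^ p

theorem continuous_defect {p : ℝ} (hp : 1 < p) :
    Continuous fun x : V × V => defect p x.1 x.2 := by
  unfold defect
  have hp0 : 0 ≤ p := by linarith
  fun_prop (disch := exact hp0)

theorem norm_half_add_le (a b : V) : ‖(1 / 2 : ℝ) • (a + b)‖ ≤ (‖a‖ + ‖b‖) / 2 := by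
  rw [norm_smul]
  have := norm_add_le a b
  norm_num
  linarith

theorem defect_nonneg {p : ℝ} (hp : 1 < p) (a b : V) : 0 ≤ defect p a b := by
  have h1 := (convexOn_rpow hp.le).2 (norm_nonneg a) (norm_nonneg b)
    (by norm_num : (0 : ℝ) ≤ 1 / 2) (by norm_num : (0 : ℝ) ≤ 1 / 2) (by norm_num)
  have h2 := Real.rpow_le_rpow (norm_nonneg _) (norm_half_add_le a b) (by linarith : 0 ≤ p)
  simp only [smul_eq_mul] at h1
  rw [show 1 / 2 * ‖a‖ + 1 / 2 * ‖b‖ = (‖a‖ + ‖b‖) / 2 by ring] at h1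
  unfold defect
  linarith

/-- For equal norms strictness comes from the parallelogram law; for different norms it comes from
strict convexity of `t ↦ t ^ p`. -/
theorem defect_pos {p : ℝ} (hp : 1 < p) {a b : V} (hab : a ≠ b) : 0 < defect p a b := by
  have hp0 : 0 < p := by linarith
  unfold defect
  by_cases hn : ‖a‖ = ‖b‖
  · have h3 : ‖(1 / 2 : ℝ) • (a + b)‖ < ‖a‖ := by
      have h4 := parallelogram_law_with_norm ℝ a b
      have h5 : 0 < ‖a - b‖ := norm_pos_iff.2 (sub_ne_zero.2 hab)
      rw [norm_smul]
      norm_num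
      rw [← hn] at h4
      have : ‖a + b‖ < 2 * ‖a‖ := by
        refine lt_of_pow_lt_pow_left₀ 2 (by positivity) ?_
        nlinarith [mul_pos h5 h5]
      linarith
    have h6 := Real.rpow_lt_rpow (norm_nonneg _) h3 hp0
    rw [← hn]
    linarith
  · have h1 := (strictConvexOn_rpow hp).2 (norm_nonneg a) (norm_nonneg b) hn
      (by norm_num : (0 : ℝ) < 1 / 2) (by norm_num : (0 : ℝ) < 1 / 2) (by norm_num)
    have h2 := Real.rpow_le_rpow (norm_nonneg _) (norm_half_add_le a b) hp0.le
    simp only [smul_eq_mul] at h1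
    rw [show 1 / 2 * ‖a‖ + 1 / 2 * ‖b‖ = (‖a‖ + ‖b‖) / 2 by ring] at h1
    linarith

theorem defect_smul {p : ℝ} {t : ℝ} (ht : 0 ≤ t) (a b : V) :
    defect p (t • a) (t • b) = t ^ p * defect p a b := by
  unfold defect
  rw [← smul_add, smul_comm, norm_smul t, norm_smul t, norm_smul t, Real.norm_of_nonneg ht,
    Real.mul_rpow ht (norm_nonneg _), Real.mul_rpow ht (norm_nonneg _),
    Real.mul_rpow ht (norm_nonneg _)]
  ring

/-- A substitute for Clarkson's inequalities that treats all `p > 1` at once. By homogeneity it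
suffices to look at the unit sphere of `V × V`. There the defect is bounded below on the compact
part where `‖a - b‖ ^ p ≥ η`, and on the rest the `η` term alone is enough. -/
theorem exists_norm_sub_rpow_le [FiniteDimensional ℝ V] {p : ℝ} (hp : 1 < p) {η : ℝ}
    (hη : 0 < η) : ∃ C : ℝ, 0 ≤ C ∧ ∀ a b : V,
      ‖a - b‖ ^ p ≤ η * (‖a‖ ^ p + ‖b‖ ^ p) + C * defect p a b := by
  have hp0 : 0 < p := by linarith
  have := FiniteDimensional.proper_real V
  let K : Set (V × V) := Metric.sphere 0 1 ∩ {x | η ≤ ‖x.1 - x.2‖ ^ p}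
  have hK : IsCompact K := (isCompact_sphere _ _).inter_right
    (isClosed_le continuous_const (by fun_prop (disch := exact hp0.le)))
  have hKpos : ∀ x ∈ K, 0 < defect p x.1 x.2 := by
    intro x hx
    refine defect_pos hp fun h => ?_
    have : η ≤ ‖x.1 - x.2‖ ^ p := hx.2
    rw [h, sub_self, norm_zero, Real.zero_rpow hp0.ne'] at this
    linarith
  obtain ⟨c, hc, hcK⟩ : ∃ c > 0, ∀ x ∈ K, c ≤ defect p x.1 x.2 := by
    rcases K.eq_empty_or_nonempty with h | h
    · exact ⟨1, one_pos, by simp [h]⟩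
    · obtain ⟨x, hx, hmin⟩ := hK.exists_isMinOn h (continuous_defect hp).continuousOn
      exact ⟨_, hKpos x hx, fun y hy => hmin hy⟩
  have hS : ∀ x : V × V, ‖x‖ = 1 →
      ‖x.1 - x.2‖ ^ p ≤ η * (‖x.1‖ ^ p + ‖x.2‖ ^ p) + 2 ^ p / c * defect p x.1 x.2 := by
    intro x hx
    have hd := defect_nonneg hp x.1 x.2
    by_cases h : η ≤ ‖x.1 - x.2‖ ^ p
    · have h1 := hcK x ⟨by simpa using hx, h⟩
      have h2 : ‖x.1 - x.2‖ ≤ 2 := by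
        have := norm_sub_le x.1 x.2
        have h3 := norm_fst_le x
        have h4 := norm_snd_le x
        linarith
      have h3 := Real.rpow_le_rpow (norm_nonneg _) h2 hp0.le
      have h4 : (2 : ℝ) ^ p ≤ 2 ^ p / c * defect p x.1 x.2 := by
        rw [div_mul_eq_mul_div, le_div_iff₀ hc]
        gcongr
      have : 0 ≤ η * (‖x.1‖ ^ p + ‖x.2‖ ^ p) := by positivity
      linarith
    -- The product carries the maximum norm, so one of the two summands equals `1`.
    · have h1 : 1 ≤ ‖x.1‖ ^ p + ‖x.2‖ ^ p := by
        have a1 : 0 ≤ ‖x.1‖ ^ p := by positivity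
        have a2 : 0 ≤ ‖x.2‖ ^ p := by positivity
        rw [Prod.norm_def] at hx
        rcases max_choice ‖x.1‖ ‖x.2‖ with h | h <;> rw [h] at hx <;> rw [hx, Real.one_rpow] <;>
          linarith
      have h2 : 0 ≤ 2 ^ p / c * defect p x.1 x.2 := by positivity
      nlinarith
  refine ⟨2 ^ p / c, by positivity, fun a b => ?_⟩
  by_cases h0 : (a, b) = (0 : V × V)
  · simp only [Prod.mk_eq_zero] at h0
    simp [h0.1, h0.2, defect, Real.zero_rpow hp0.ne']
  · set t := ‖(a, b)‖ with ht
    have htpos : 0 < t := norm_pos_iff.2 h0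
    have key := hS (t⁻¹ • (a, b)) (by rw [norm_smul, norm_inv, norm_norm, inv_mul_cancel₀ htpos.ne'])
    simp only [Prod.smul_mk] at key
    have hti : 0 ≤ t⁻¹ := by positivity
    rw [defect_smul hti, ← smul_sub, norm_smul, norm_smul, norm_smul, Real.norm_of_nonneg hti,
      Real.mul_rpow hti (norm_nonneg _), Real.mul_rpow hti (norm_nonneg _),
      Real.mul_rpow hti (norm_nonneg _)] at key
    have h1 : 0 < t⁻¹ ^ p := by positivity
    refine le_of_mul_le_mul_left ?_ h1
    linarith

end Convexity

/-! ### Limits and completeness in `L^p` -/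

section Lp

variable {α V W Z : Type*} [MeasurableSpace α] {μ : Measure α}
  [NormedAddCommGroup V] [NormedSpace ℝ V] [NormedAddCommGroup W] [NormedSpace ℝ W]
  [NormedAddCommGroup Z] [NormedSpace ℝ Z]

theorem one_le_ofReal {p : ℝ} (hp : 1 < p) : 1 ≤ ENNReal.ofReal p := by
  simpa using ENNReal.ofReal_le_ofReal hp.le

theorem holderTriple_ofReal {p q : ℝ} (hpq : p.HolderConjugate q) :
    ENNReal.HolderTriple (ENNReal.ofReal q) (ENNReal.ofReal p) 1 := by
  have := hpq.symm.ennrealOfReal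
  exact this

theorem integrable_bilin {p q : ℝ} (hpq : p.HolderConjugate q) (B : V →L[ℝ] W →L[ℝ] Z)
    {f : α → V} {g : α → W} (hf : MemLp f (ENNReal.ofReal q) μ)
    (hg : MemLp g (ENNReal.ofReal p) μ) : Integrable (fun x => B (f x) (g x)) μ := by
  have := holderTriple_ofReal hpq
  rw [← memLp_one_iff_integrable]
  exact B.memLp_of_bilin 1 hf hg

/-- Hölder's inequality makes the pairing with a fixed `L^q` function continuous on `L^p`. This
serves every later passage to the limit in an expression linear in `u` or `∇u`, including `∫ u`,
where the fixed function is `1`. -/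
theorem tendsto_integral_bilin {p q : ℝ} (hpq : p.HolderConjugate q) (B : V →L[ℝ] W →L[ℝ] Z)
    {f : α → V} {G : ℕ → α → W} {g : α → W} (hf : MemLp f (ENNReal.ofReal q) μ)
    (hG : ∀ n, MemLp (G n) (ENNReal.ofReal p) μ) (hg : MemLp g (ENNReal.ofReal p) μ)
    (h : Tendsto (fun n => eLpNorm (fun x => G n x - g x) (ENNReal.ofReal p) μ) atTop (𝓝 0)) :
    Tendsto (fun n => ∫ x, B (f x) (G n x) ∂μ) atTop (𝓝 (∫ x, B (f x) (g x) ∂μ)) := by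
  have := holderTriple_ofReal hpq
  refine tendsto_integral_of_L1' _ (integrable_bilin hpq B hf hg).aestronglyMeasurable
    (Eventually.of_forall fun n => integrable_bilin hpq B hf (hG n)) ?_
  have hb : ∀ n, eLpNorm ((fun x => B (f x) (G n x)) - fun x => B (f x) (g x)) 1 μ ≤
      ENNReal.ofNNReal ‖B‖₊ * eLpNorm f (ENNReal.ofReal q) μ *
        eLpNorm (fun x => G n x - g x) (ENNReal.ofReal p) μ := by
    intro n
    have h1 := eLpNorm_le_eLpNorm_mul_eLpNorm_of_nnnorm (μ := μ) (r := 1)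
      hf.aestronglyMeasurable ((hG n).sub hg).aestronglyMeasurable (fun v w => B v w) ‖B‖₊
      (Eventually.of_forall fun x => by
        rw [← NNReal.coe_le_coe]
        push_cast
        exact B.le_opNorm₂ _ _)
      (p := ENNReal.ofReal q) (q := ENNReal.ofReal p)
    refine le_trans (le_of_eq ?_) h1
    congr 1
    ext x
    simp
  have h2 : Tendsto (fun n => ENNReal.ofNNReal ‖B‖₊ * eLpNorm f (ENNReal.ofReal q) μ *
        eLpNorm (fun x => G n x - g x) (ENNReal.ofReal p) μ) atTop (𝓝 0) := by
    have := ENNReal.Tendsto.const_mul (a := ENNReal.ofNNReal ‖B‖₊ * eLpNorm f (ENNReal.ofReal q) μ)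
      h (Or.inr (ENNReal.mul_ne_top ENNReal.coe_ne_top hf.2.ne))
    simpa using this
  exact tendsto_of_tendsto_of_tendsto_of_le_of_le tendsto_const_nhds h2 (fun _ => zero_le) hb

theorem eLpNorm_toReal_rpow {p : ℝ} (hp : 1 < p) {f : α → V}
    (hf : MemLp f (ENNReal.ofReal p) μ) :
    (eLpNorm f (ENNReal.ofReal p) μ).toReal = (∫ x, ‖f x‖ ^ p ∂μ) ^ (1 / p) := by
  have hp0 : 0 < p := by linarith
  rw [hf.eLpNorm_eq_integral_rpow_norm (by simpa using hp0) ENNReal.ofReal_ne_top,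
    ENNReal.toReal_ofReal (by positivity), ENNReal.toReal_ofReal hp0.le, one_div]

theorem integrable_norm_rpow {p : ℝ} (hp : 1 < p) {f : α → V}
    (hf : MemLp f (ENNReal.ofReal p) μ) : Integrable (fun x => ‖f x‖ ^ p) μ := by
  have hp0 : 0 < p := by linarith
  have := hf.integrable_norm_rpow (by simpa using hp0) ENNReal.ofReal_ne_top
  rwa [ENNReal.toReal_ofReal hp0.le] at this

theorem tendsto_integral_norm_rpow {p : ℝ} (hp : 1 < p) {G : ℕ → α → V} {g : α → V}
    (hG : ∀ n, MemLp (G n) (ENNReal.ofReal p) μ) (hg : MemLp g (ENNReal.ofReal p) μ)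
    (h : Tendsto (fun n => eLpNorm (fun x => G n x - g x) (ENNReal.ofReal p) μ) atTop (𝓝 0)) :
    Tendsto (fun n => ∫ x, ‖G n x‖ ^ p ∂μ) atTop (𝓝 (∫ x, ‖g x‖ ^ p ∂μ)) := by
  have hp0 : 0 < p := by linarith
  have : Fact (1 ≤ ENNReal.ofReal p) := ⟨one_le_ofReal hp⟩
  have h1 : Tendsto (fun n => (hG n).toLp (G n)) atTop (𝓝 (hg.toLp g)) := by
    rw [Lp.tendsto_Lp_iff_tendsto_eLpNorm'' _ hG _ hg]
    exact h
  have h2 := (h1.norm).rpow_const (p := p) (Or.inr hp0.le)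
  have h3 : ∀ f : α → V, ∀ hf : MemLp f (ENNReal.ofReal p) μ,
      ‖hf.toLp f‖ ^ p = ∫ x, ‖f x‖ ^ p ∂μ := by
    intro f hf
    have h0 : 0 ≤ ∫ x, ‖f x‖ ^ p ∂μ := integral_nonneg fun x => by positivity
    rw [Lp.norm_toLp, eLpNorm_toReal_rpow hp hf, ← Real.rpow_mul h0, one_div_mul_cancel hp0.ne',
      Real.rpow_one]
  simp only [h3] at h2
  exact h2

/-- Completeness of `L^p` for sequences of functions. -/
theorem exists_limit_of_integral_cauchy [CompleteSpace V] {p : ℝ} (hp : 1 < p) {G : ℕ → α → V}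
    (hG : ∀ n, MemLp (G n) (ENNReal.ofReal p) μ)
    (h : ∀ ε > 0, ∃ N, ∀ m ≥ N, ∀ n ≥ N, ∫ x, ‖G m x - G n x‖ ^ p ∂μ < ε) :
    ∃ g : α → V, MemLp g (ENNReal.ofReal p) μ ∧
      Tendsto (fun n => eLpNorm (fun x => G n x - g x) (ENNReal.ofReal p) μ) atTop (𝓝 0) := by
  have hp0 : 0 < p := by linarith
  have : Fact (1 ≤ ENNReal.ofReal p) := ⟨one_le_ofReal hp⟩
  have hc : CauchySeq fun n => (hG n).toLp (G n) := by
    rw [Metric.cauchySeq_iff]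
    intro ε hε
    obtain ⟨N, hN⟩ := h (ε ^ p) (by positivity)
    refine ⟨N, fun m hm n hn => ?_⟩
    rw [dist_eq_norm, ← MemLp.toLp_sub, Lp.norm_toLp, eLpNorm_toReal_rpow hp ((hG m).sub (hG n))]
    have h1 := Real.rpow_lt_rpow (integral_nonneg fun x => by positivity) (hN m hm n hn)
      (by positivity : 0 < 1 / p)
    rwa [← Real.rpow_mul hε.le, mul_one_div_cancel hp0.ne', Real.rpow_one] at h1
  obtain ⟨g, hg⟩ := cauchySeq_tendsto_of_complete hc
  refine ⟨g, Lp.memLp g, ?_⟩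
  have := (Lp.tendsto_Lp_iff_tendsto_eLpNorm' _ _).1 hg
  refine this.congr fun n => eLpNorm_congr_ae ?_
  filter_upwards [(hG n).coeFn_toLp] with x hx
  simp [hx]

end Lp

/-! ### Hölder's inequality, test functions and the Poincaré inequality -/

section

section Holder

variable {α V : Type*} [MeasurableSpace α] {μ : Measure α} [NormedAddCommGroup V]

theorem memLp_norm_rpow_sub_one {p q : ℝ} (hpq : p.HolderConjugate q) {f : α → V}
    (hf : MemLp f (ENNReal.ofReal p) μ) :
    MemLp (fun x => ‖f x‖ ^ (p - 1)) (ENNReal.ofReal q) μ := by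
  have hp := hpq.lt
  have h := hf.norm_rpow_div (ENNReal.ofReal (p - 1))
  rw [ENNReal.toReal_ofReal (by linarith), ← ENNReal.ofReal_div_of_pos (by linarith)] at h
  rwa [hpq.conjugate_eq]

/-- Hölder's inequality with `(p - 1) q = p`; writing `1 / q` as `1 - 1 / p` removes the conjugate
exponent from the statement. -/
theorem integral_norm_rpow_mul_le {p : ℝ} (hp : 1 < p) {f : α → V} {b : α → ℝ}
    (hf : MemLp f (ENNReal.ofReal p) μ) (hb : MemLp b (ENNReal.ofReal p) μ) (hb0 : ∀ x, 0 ≤ b x) :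
    ∫ x, ‖f x‖ ^ (p - 1) * b x ∂μ ≤
      (∫ x, ‖f x‖ ^ p ∂μ) ^ (1 - 1 / p) * (∫ x, b x ^ p ∂μ) ^ (1 / p) := by
  have hpq := Real.HolderConjugate.conjExponent hp
  set q := Real.conjExponent p
  have h := integral_mul_le_Lp_mul_Lq_of_nonneg (μ := μ) hpq.symm
    (f := fun x => ‖f x‖ ^ (p - 1)) (g := b)
    (Eventually.of_forall fun x => by positivity) (Eventually.of_forall hb0)
    (memLp_norm_rpow_sub_one hpq hf) hb
  have h1 : ∀ x, (‖f x‖ ^ (p - 1)) ^ q = ‖f x‖ ^ p := fun x => by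
    rw [← Real.rpow_mul (norm_nonneg _), hpq.sub_one_mul_conj]
  have h2 : 1 / q = 1 - 1 / p := by
    have := hpq.inv_add_inv_eq_one
    rw [one_div, one_div]
    linarith
  simpa only [h1, h2] using h

end Holder

variable {D : ℕ} {Ω : Set (E D)} {φ ψ : E D → ℝ}

theorem gradient_def (f : E D → ℝ) (x : E D) :
    gradient f x = (InnerProductSpace.toDual ℝ (E D)).symm (fderiv ℝ f x) := rfl

theorem inner_gradient_left (f : E D → ℝ) (x v : E D) :
    inner ℝ (gradient f x) v = fderiv ℝ f x v := by
  rw [gradient_def, InnerProductSpace.toDual_symm_apply]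

theorem norm_gradient (f : E D → ℝ) (x : E D) : ‖gradient f x‖ = ‖fderiv ℝ f x‖ := by
  rw [gradient_def, LinearIsometryEquiv.norm_map]

theorem continuous_gradient {f : E D → ℝ} (hf : ContDiff ℝ 1 f) : Continuous (gradient f) :=
  (InnerProductSpace.toDual ℝ (E D)).symm.continuous.comp (hf.continuous_fderiv one_ne_zero)

theorem gradient_eq_zero_of_notMem_tsupport {f : E D → ℝ} {x : E D} (h : x ∉ tsupport f) :
    gradient f x = 0 := by
  rw [gradient_def, fderiv_of_notMem_tsupport ℝ h, map_zero]

theorem hasCompactSupport_gradient {f : E D → ℝ} (hf : HasCompactSupport f) :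
    HasCompactSupport (gradient f) :=
  hf.mono' fun x hx => by
    by_contra h
    exact hx (gradient_eq_zero_of_notMem_tsupport h)

theorem gradient_add' {f g : E D → ℝ} {x : E D} (hf : DifferentiableAt ℝ f x)
    (hg : DifferentiableAt ℝ g x) :
    gradient (fun y => f y + g y) x = gradient f x + gradient g x := by
  simp only [gradient_def, ← map_add]
  congr 1
  exact fderiv_add hf hg

theorem gradient_const_mul' {f : E D → ℝ} {x : E D} (c : ℝ) :
    gradient (fun y => c * f y) x = c • gradient f x := by
  simp only [gradient_def]
  rw [← map_smul]
  congr 1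
  exact congrFun (fderiv_const_smul_field (𝕜 := ℝ) (f := f) c) x

namespace IsTestFunction

theorem contDiff_one (h : IsTestFunction Ω φ) : ContDiff ℝ 1 φ := h.1.of_le (by exact_mod_cast le_top)

theorem differentiable (h : IsTestFunction Ω φ) : Differentiable ℝ φ :=
  h.contDiff_one.differentiable one_ne_zero

theorem add (h : IsTestFunction Ω φ) (h' : IsTestFunction Ω ψ) :
    IsTestFunction Ω fun x => φ x + ψ x :=
  ⟨h.1.add h'.1, h.2.1.add h'.2.1, (tsupport_add φ ψ).trans (Set.union_subset h.2.2 h'.2.2)⟩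

theorem const_mul (h : IsTestFunction Ω φ) (c : ℝ) : IsTestFunction Ω fun x => c * φ x :=
  ⟨contDiff_const.mul h.1, h.2.1.mul_left, (closure_mono (Function.support_mul_subset_right (fun _ => c) φ)).trans
    h.2.2⟩

theorem zero : IsTestFunction Ω fun _ => (0 : ℝ) :=
  ⟨contDiff_const, HasCompactSupport.zero, by simp [tsupport, Function.support]⟩

theorem gradient_add (h : IsTestFunction Ω φ) (h' : IsTestFunction Ω ψ) (x : E D) :
    gradient (fun y => φ y + ψ y) x = gradient φ x + gradient ψ x :=
  gradient_add' (h.differentiable x) (h'.differentiable x)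

theorem eq_zero (h : IsTestFunction Ω φ) {x : E D} (hx : x ∉ Ω) : φ x = 0 :=
  image_eq_zero_of_notMem_tsupport fun h' => hx (h.2.2 h')

theorem gradient_eq_zero (h : IsTestFunction Ω φ) {x : E D} (hx : x ∉ Ω) : gradient φ x = 0 :=
  gradient_eq_zero_of_notMem_tsupport fun h' => hx (h.2.2 h')

theorem continuous_gradient (h : IsTestFunction Ω φ) : Continuous (gradient φ) :=
  PTorsion.continuous_gradient h.contDiff_one

theorem integrable (h : IsTestFunction Ω φ) : Integrable φ :=
  h.1.continuous.integrable_of_hasCompactSupport h.2.1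

theorem memLp (h : IsTestFunction Ω φ) (r : ENNReal) : MemLp φ r volume :=
  h.1.continuous.memLp_of_hasCompactSupport h.2.1

theorem memLp_gradient (h : IsTestFunction Ω φ) (r : ENNReal) : MemLp (gradient φ) r volume :=
  h.continuous_gradient.memLp_of_hasCompactSupport (hasCompactSupport_gradient h.2.1)

theorem setIntegral_eq (h : IsTestFunction Ω φ) : ∫ x in Ω, φ x = ∫ x, φ x :=
  setIntegral_eq_integral_of_forall_compl_eq_zero fun _ hx => h.eq_zero hx

theorem setIntegral_norm_gradient_rpow (h : IsTestFunction Ω φ) {p : ℝ} (hp : 1 < p) :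
    ∫ x in Ω, ‖gradient φ x‖ ^ p = ∫ x, ‖gradient φ x‖ ^ p :=
  setIntegral_eq_integral_of_forall_compl_eq_zero fun x hx => by
    rw [h.gradient_eq_zero hx, norm_zero, Real.zero_rpow (by linarith)]

theorem setIntegral_norm_rpow (h : IsTestFunction Ω φ) {p : ℝ} (hp : 1 < p) :
    ∫ x in Ω, ‖φ x‖ ^ p = ∫ x, ‖φ x‖ ^ p :=
  setIntegral_eq_integral_of_forall_compl_eq_zero fun x hx => by
    rw [h.eq_zero hx, norm_zero, Real.zero_rpow (by linarith)]

end IsTestFunction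

/-- Integration by parts in a fixed direction. -/
theorem integral_mul_fderiv_of_compactSupport {f g : E D → ℝ} (hf : ContDiff ℝ 1 f)
    (hg : ContDiff ℝ 1 g) (hc : HasCompactSupport g) (v : E D) :
    ∫ x, f x * fderiv ℝ g x v = -∫ x, fderiv ℝ f x v * g x := by
  have hf' : Continuous fun x => fderiv ℝ f x v :=
    (hf.continuous_fderiv one_ne_zero).clm_apply continuous_const
  have hg' : Continuous fun x => fderiv ℝ g x v :=
    (hg.continuous_fderiv one_ne_zero).clm_apply continuous_const
  have hgc : HasCompactSupport fun x => fderiv ℝ g x v := hc.fderiv_apply ℝ v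
  exact integral_mul_fderiv_eq_neg_fderiv_mul_of_integrable
    ((hf'.mul hg.continuous).integrable_of_hasCompactSupport hc.mul_left)
    ((hf.continuous.mul hg').integrable_of_hasCompactSupport hgc.mul_left)
    ((hf.continuous.mul hg.continuous).integrable_of_hasCompactSupport hc.mul_left)
    (fun x _ => hf.differentiable one_ne_zero x) (fun x _ => hg.differentiable one_ne_zero x)

theorem IsTestFunction.isWeakGradient (h : IsTestFunction Ω φ) :
    IsWeakGradient Ω φ (gradient φ) := by
  intro ψ hψ
  rw [setIntegral_eq_integral_of_forall_compl_eq_zero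
      (fun x hx => by rw [h.eq_zero hx, zero_smul]),
    setIntegral_eq_integral_of_forall_compl_eq_zero
      (fun x hx => by rw [hψ.eq_zero hx, zero_smul])]
  have i1 : Integrable fun x => φ x • gradient ψ x :=
    (h.1.continuous.smul hψ.continuous_gradient).integrable_of_hasCompactSupport
      h.2.1.smul_right
  have i2 : Integrable fun x => ψ x • gradient φ x :=
    (hψ.1.continuous.smul h.continuous_gradient).integrable_of_hasCompactSupport
      hψ.2.1.smul_right
  refine ext_inner_left ℝ fun v => ?_
  rw [inner_neg_right, ← integral_inner i1, ← integral_inner i2]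
  simp only [real_inner_comm _ v, inner_smul_left, inner_gradient_left, conj_trivial]
  rw [integral_mul_fderiv_of_compactSupport h.contDiff_one hψ.contDiff_one hψ.2.1]
  simp only [mul_comm]

/-- The divergence theorem for `f x • x`. -/
theorem integral_fderiv_self {f : E D → ℝ} (hf : ContDiff ℝ 1 f) (hc : HasCompactSupport f) :
    ∫ x, fderiv ℝ f x x = -(D * ∫ x, f x) := by
  let e : Fin D → E D := fun i => EuclideanSpace.single i 1
  have hx : ∀ x : E D, fderiv ℝ f x x = ∑ i, x i * fderiv ℝ f x (e i) := by
    intro x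
    have : x = ∑ i, x i • e i := by
      have := (EuclideanSpace.basisFun (Fin D) ℝ).sum_repr x
      simpa [e] using this.symm
    calc fderiv ℝ f x x = fderiv ℝ f x (∑ i, x i • e i) := by rw [← this]
      _ = _ := by rw [map_sum]; simp only [map_smul, smul_eq_mul]
  have hi : ∀ i, ∫ x : E D, x i * fderiv ℝ f x (e i) = -∫ x, f x := by
    intro i
    let P : E D →L[ℝ] ℝ := EuclideanSpace.proj i
    -- Integration by parts against the coordinate function, whose derivative along `e i` is `1`;
    -- the sum over `i` produces the factor `D`.
    have := integral_mul_fderiv_of_compactSupport (f := P) P.contDiff hf hc (e i)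
    have hP : P (e i) = 1 := by simp [P, e]
    simp only [P.fderiv, hP, one_mul] at this
    exact this
  simp only [hx]
  rw [integral_finsetSum]
  · simp [hi]
  · intro i _
    have hfc : Continuous fun x => fderiv ℝ f x (e i) :=
      (hf.continuous_fderiv one_ne_zero).clm_apply continuous_const
    exact ((by fun_prop : Continuous fun x : E D => x i).mul hfc).integrable_of_hasCompactSupport
      (hc.fderiv_apply ℝ (e i)).mul_left

theorem contDiff_norm_rpow_comp {p : ℝ} (hp : 1 < p) (h : IsTestFunction Ω φ) :
    ContDiff ℝ 1 fun x => ‖φ x‖ ^ p :=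
  (contDiff_norm_rpow hp).comp h.contDiff_one

/-- The Poincaré inequality. -/
theorem poincare (hD : 0 < D) {p : ℝ} (hp : 1 < p) {r : ℝ} (hr : 0 ≤ r)
    (hΩ : ∀ x ∈ Ω, ‖x‖ ≤ r) (h : IsTestFunction Ω φ) :
    ∫ x, ‖φ x‖ ^ p ≤ (p * r / D) ^ p * ∫ x, ‖gradient φ x‖ ^ p := by
  have hp0 : 0 < p := by linarith
  have hD' : (0 : ℝ) < D := by exact_mod_cast hD
  have hcs : HasCompactSupport fun x => ‖φ x‖ ^ p :=
    h.2.1.norm.comp_left (g := fun t : ℝ => t ^ p) (Real.zero_rpow hp0.ne')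
  -- The divergence theorem for `|φ|^p x` expresses `D ∫ |φ|^p` through `∇|φ|^p · x`, which is at
  -- most `p r |φ|^(p-1) |∇φ|` in absolute value. Hölder's inequality then leaves a power of `∫
  -- |φ|^p` to cancel.
  have h1 := integral_fderiv_self (contDiff_norm_rpow_comp hp h) hcs
  set A := ∫ x, ‖φ x‖ ^ p with hA
  set B := ∫ x, ‖gradient φ x‖ ^ p with hB
  have hA0 : 0 ≤ A := integral_nonneg fun x => by positivity
  have hB0 : 0 ≤ B := integral_nonneg fun x => by positivity
  have hpt : ∀ x, -(fderiv ℝ (fun x => ‖φ x‖ ^ p) x x) ≤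
      p * r * (‖φ x‖ ^ (p - 1) * ‖gradient φ x‖) := by
    intro x
    by_cases hx : x ∈ Ω
    · have hd : fderiv ℝ (fun x => ‖φ x‖ ^ p) x =
          ((p * ‖φ x‖ ^ (p - 2)) • innerSL ℝ (φ x)).comp (fderiv ℝ φ x) :=
        ((hasFDerivAt_norm_rpow (φ x) hp).comp x (h.differentiable x).hasFDerivAt).fderiv
      rw [hd]
      refine (neg_le_abs _).trans ?_
      have h2 : ‖φ x‖ ^ (p - 2) * |φ x| ≤ ‖φ x‖ ^ (p - 1) := by
        rw [← Real.norm_eq_abs]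
        by_cases h0 : ‖φ x‖ = 0
        · rw [h0, mul_zero]; positivity
        · rw [← Real.rpow_add_one h0]; ring_nf; rfl
      have h3 : |fderiv ℝ φ x x| ≤ ‖gradient φ x‖ * r := by
        rw [norm_gradient]
        exact ((fderiv ℝ φ x).le_opNorm x).trans (by gcongr; exact hΩ x hx)
      have h4 : |(((p * ‖φ x‖ ^ (p - 2)) • innerSL ℝ (φ x)).comp (fderiv ℝ φ x)) x| =
          p * (‖φ x‖ ^ (p - 2) * |φ x|) * |fderiv ℝ φ x x| := by
        simp only [ContinuousLinearMap.comp_apply, _root_.smul_apply, smul_eq_mul,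
          innerSL_apply_apply, RCLike.inner_apply, conj_trivial, abs_mul, abs_of_pos hp0]
        rw [abs_of_nonneg (by positivity : 0 ≤ ‖φ x‖ ^ (p - 2))]
        ring
      rw [h4]
      calc _ ≤ p * ‖φ x‖ ^ (p - 1) * (‖gradient φ x‖ * r) := by gcongr
        _ = _ := by ring
    · have : x ∉ tsupport fun x => ‖φ x‖ ^ p := by
        intro h'
        refine hx (h.2.2 (closure_mono ?_ h'))
        intro y hy hy0
        apply hy
        simp only at hy0 ⊢
        rw [hy0, norm_zero, Real.zero_rpow hp0.ne']
      rw [fderiv_of_notMem_tsupport ℝ this]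
      simp only [_root_.zero_apply, neg_zero]
      positivity
  have i1 : Integrable fun x => ‖φ x‖ ^ (p - 1) * ‖gradient φ x‖ := by
    refine Continuous.integrable_of_hasCompactSupport ?_
      ((hasCompactSupport_gradient h.2.1).norm.mul_left)
    have := h.continuous_gradient
    have h2 := h.1.continuous
    have h3 : 0 ≤ p - 1 := by linarith
    fun_prop (disch := exact h3)
  have i2 : Integrable fun x => fderiv ℝ (fun x => ‖φ x‖ ^ p) x x := by
    refine Continuous.integrable_of_hasCompactSupport ?_ ?_
    · exact ((contDiff_norm_rpow_comp hp h).continuous_fderiv one_ne_zero).clm_apply continuous_id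
    · refine (hcs.fderiv (𝕜 := ℝ)).mono fun x hx => ?_
      intro h0
      exact hx (by simp only; rw [h0]; rfl)
  have h5 : D * A ≤ p * r * (A ^ (1 - 1 / p) * B ^ (1 / p)) := by
    calc D * A = ∫ x, -(fderiv ℝ (fun x => ‖φ x‖ ^ p) x x) := by
          rw [integral_neg, h1, neg_neg]
      _ ≤ ∫ x, p * r * (‖φ x‖ ^ (p - 1) * ‖gradient φ x‖) :=
          integral_mono i2.neg (i1.const_mul _) hpt
      _ = p * r * ∫ x, ‖φ x‖ ^ (p - 1) * ‖gradient φ x‖ := integral_const_mul _ _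
      _ ≤ _ := by
          gcongr
          exact integral_norm_rpow_mul_le hp (h.memLp _) (h.memLp_gradient _).norm
            fun x => norm_nonneg _
  rcases hA0.eq_or_lt with h0 | hApos
  · rw [← h0]; positivity
  · have h6 : A ^ (1 / p) ≤ p * r / D * B ^ (1 / p) := by
      rw [Real.rpow_sub hApos, Real.rpow_one] at h5
      have h7 : 0 < A ^ (1 / p) := by positivity
      field_simp at h5 ⊢
      linarith
    have h8 := Real.rpow_le_rpow (by positivity) h6 hp0.le
    rwa [Real.mul_rpow (by positivity) (by positivity), ← Real.rpow_mul hA0,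
      ← Real.rpow_mul hB0, one_div_mul_cancel hp0.ne', Real.rpow_one, Real.rpow_one] at h8

end

/-! ### Existence of the torsion function by the direct method -/

section

variable {D : ℕ} {Ω : Set (E D)} {φ ψ : E D → ℝ} {p : ℝ}

/-- The functional minimized by the `p`-torsion function. -/
def torsionEnergy (p : ℝ) (Ω : Set (E D)) (φ : E D → ℝ) : ℝ :=
  (1 / p) * (∫ x in Ω, ‖gradient φ x‖ ^ p) - ∫ x in Ω, φ x

/-- Hölder's inequality against the constant `1` on the bounded set, followed by the Poincaré
inequality. -/
theorem exists_abs_integral_le (hD : 0 < D) (hp : 1 < p) (hb : Bornology.IsBounded Ω) :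
    ∃ K, 0 ≤ K ∧ ∀ φ, IsTestFunction Ω φ →
      |∫ x in Ω, φ x| ≤ K * (∫ x in Ω, ‖gradient φ x‖ ^ p) ^ (1 / p) := by
  have hp0 : 0 < p := by linarith
  obtain ⟨r, hr⟩ := hb.exists_norm_le
  have hr' : ∀ x ∈ Ω, ‖x‖ ≤ max r 0 := fun x hx => (hr x hx).trans (le_max_left _ _)
  have hfin : IsFiniteMeasure (volume.restrict Ω) := ⟨by simpa using hb.measure_lt_top⟩
  refine ⟨(∫ x in Ω, ‖(1 : ℝ)‖ ^ p) ^ (1 - 1 / p) * (p * max r 0 / D), by positivity,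
    fun φ hφ => ?_⟩
  have h1 := integral_norm_rpow_mul_le (μ := volume.restrict Ω) hp (f := fun _ : E D => (1 : ℝ))
    (memLp_const 1) ((hφ.memLp _).restrict Ω).norm fun x => norm_nonneg _
  have h2 := Real.rpow_le_rpow (integral_nonneg fun x => by positivity)
    (poincare hD hp (le_max_right r 0) hr' hφ) (by positivity : 0 ≤ 1 / p)
  rw [Real.mul_rpow (by positivity) (integral_nonneg fun x => by positivity),
    ← Real.rpow_mul (by positivity), mul_one_div_cancel hp0.ne', Real.rpow_one,
    ← hφ.setIntegral_norm_rpow hp, ← hφ.setIntegral_norm_gradient_rpow hp] at h2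
  calc |∫ x in Ω, φ x| ≤ ∫ x in Ω, ‖φ x‖ := abs_integral_le_integral_abs
    _ = ∫ x in Ω, ‖(1 : ℝ)‖ ^ (p - 1) * ‖φ x‖ := by simp
    _ ≤ _ := h1
    _ ≤ _ := by
      rw [mul_assoc]
      gcongr

/-- Coercivity: Young's inequality, with the factors weighted by `2 ^ (1 / p)`, absorbs the linear
term into exactly half of the gradient term. -/
theorem exists_torsionEnergy_ge (hD : 0 < D) (hp : 1 < p) (hb : Bornology.IsBounded Ω) :
    ∃ C, ∀ φ, IsTestFunction Ω φ →
      (∫ x in Ω, ‖gradient φ x‖ ^ p) / (2 * p) - C ≤ torsionEnergy p Ω φ := by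
  have hp0 : 0 < p := by linarith
  obtain ⟨K, hK, h⟩ := exists_abs_integral_le hD hp hb
  have hpq := Real.HolderConjugate.conjExponent hp
  set q := Real.conjExponent p
  refine ⟨(2 ^ (1 / p) * K) ^ q / q, fun φ hφ => ?_⟩
  set e := ∫ x in Ω, ‖gradient φ x‖ ^ p with he
  have he0 : 0 ≤ e := integral_nonneg fun x => by positivity
  have h2 : (0 : ℝ) < 2 ^ (1 / p) := by positivity
  have hy := Real.young_inequality_of_nonneg (a := e ^ (1 / p) / 2 ^ (1 / p))
    (b := 2 ^ (1 / p) * K) (by positivity) (by positivity) hpq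
  rw [← Real.div_rpow he0 (by norm_num), ← Real.rpow_mul (by positivity),
    one_div_mul_cancel hp0.ne', Real.rpow_one, Real.div_rpow he0 (by norm_num)] at hy
  have h3 : e ^ (1 / p) / 2 ^ (1 / p) * (2 ^ (1 / p) * K) = K * e ^ (1 / p) := by
    field_simp
  rw [h3] at hy
  have h4 := (le_abs_self _).trans (h φ hφ)
  unfold torsionEnergy
  rw [← he] at h4 ⊢
  have h5 : 1 / p * e = e / (2 * p) + e / 2 / p := by field_simp; norm_num
  linarith

theorem IsTestFunction.integrable_gradient_rpow (h : IsTestFunction Ω φ) (hp : 1 < p) :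
    Integrable (fun x => ‖gradient φ x‖ ^ p) (volume.restrict Ω) :=
  integrable_norm_rpow hp ((h.memLp_gradient _).restrict Ω)

/-- The convexity defect of a pair of test functions is controlled by their energies. -/
theorem integral_defect_le (hp : 1 < p) {m : ℝ}
    (hm : ∀ φ, IsTestFunction Ω φ → m ≤ torsionEnergy p Ω φ)
    (hφ : IsTestFunction Ω φ) (hψ : IsTestFunction Ω ψ) :
    Integrable (fun x => defect p (gradient φ x) (gradient ψ x)) (volume.restrict Ω) ∧
    ∫ x in Ω, defect p (gradient φ x) (gradient ψ x) ≤
      p * ((torsionEnergy p Ω φ + torsionEnergy p Ω ψ) / 2 - m) := by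
  have hp0 : 0 < p := by linarith
  -- The midpoint is again a competitor, so its energy is at least `m`. In the comparison with the
  -- mean of the two energies the linear terms cancel and only the defect of the gradients is left.
  have hχ := (hφ.add hψ).const_mul (1 / 2)
  have hg : ∀ x, gradient (fun y => 1 / 2 * (φ y + ψ y)) x =
      (1 / 2 : ℝ) • (gradient φ x + gradient ψ x) := fun x => by
    rw [gradient_const_mul', hφ.gradient_add hψ]
  have i1 := hφ.integrable_gradient_rpow hp
  have i2 := hψ.integrable_gradient_rpow hp
  have i3 := hχ.integrable_gradient_rpow hp
  have hJ := hm _ hχ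
  unfold torsionEnergy at hJ ⊢
  simp only [hg] at i3 hJ
  rw [integral_const_mul, integral_add hφ.integrable.restrict hψ.integrable.restrict] at hJ
  refine ⟨((i1.add i2).div_const 2).sub i3, ?_⟩
  unfold defect
  rw [integral_sub (show Integrable (fun x => (‖gradient φ x‖ ^ p + ‖gradient ψ x‖ ^ p) / 2)
      (volume.restrict Ω) from (i1.add i2).div_const 2) i3, integral_div, integral_add i1 i2]
  set a := ∫ x in Ω, ‖gradient φ x‖ ^ p
  set b := ∫ x in Ω, ‖gradient ψ x‖ ^ p
  set c := ∫ x in Ω, ‖(1 / 2 : ℝ) • (gradient φ x + gradient ψ x)‖ ^ p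
  have : p * ((1 / p * a - ∫ x in Ω, φ x) + (1 / p * b - ∫ x in Ω, ψ x)) =
      a + b - p * ((∫ x in Ω, φ x) + ∫ x in Ω, ψ x) := by field_simp; ring
  have h2 : p * m ≤ c - p * (1 / 2 * ((∫ x in Ω, φ x) + ∫ x in Ω, ψ x)) := by
    have := mul_le_mul_of_nonneg_left hJ hp0.le
    rwa [mul_sub, ← mul_assoc p (1 / p), mul_one_div_cancel hp0.ne', one_mul] at this
  nlinarith

theorem gradient_sub_test (hφ : IsTestFunction Ω φ) (hψ : IsTestFunction Ω ψ) (x : E D) :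
    gradient (fun y => φ y + -1 * ψ y) x = gradient φ x - gradient ψ x := by
  rw [hφ.gradient_add (hψ.const_mul _), gradient_const_mul', neg_one_smul, sub_eq_add_neg]

/-- A minimizing sequence is a Cauchy sequence in `W^{1,p}`. -/
theorem integral_cauchy_of_minimizing (hp : 1 < p) {m B : ℝ}
    (hm : ∀ φ, IsTestFunction Ω φ → m ≤ torsionEnergy p Ω φ) {Φ : ℕ → E D → ℝ}
    (hΦ : ∀ n, IsTestFunction Ω (Φ n))
    (hB : ∀ n, ∫ x in Ω, ‖gradient (Φ n) x‖ ^ p ≤ B)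
    (hlim : Tendsto (fun n => torsionEnergy p Ω (Φ n)) atTop (𝓝 m)) {ε : ℝ} (hε : 0 < ε) :
    ∃ N, ∀ k ≥ N, ∀ n ≥ N, ∫ x in Ω, ‖gradient (Φ k) x - gradient (Φ n) x‖ ^ p < ε := by
  have hB0 : 0 ≤ B := (integral_nonneg fun x => by positivity).trans (hB 0)
  -- With both gradient terms bounded by `B`, this `η` makes the first contribution at most `ε / 2`.
  -- The energy tolerance below, which involves the resulting `C`, makes the defect contribution at
  -- most `ε / 4`.
  obtain ⟨C, hC, hCab⟩ := exists_norm_sub_rpow_le (V := E D) hp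
    (η := ε / (4 * (B + 1))) (by positivity)
  have hp0 : 0 < p := by linarith
  have hev : ∀ᶠ n in atTop, torsionEnergy p Ω (Φ n) < m + ε / (4 * (p * (C + 1))) :=
    hlim.eventually_lt_const (by have : 0 < ε / (4 * (p * (C + 1))) := by positivity
                                 linarith)
  obtain ⟨N, hN⟩ := eventually_atTop.1 hev
  refine ⟨N, fun k hk n hn => ?_⟩
  obtain ⟨hi, hle⟩ := integral_defect_le hp hm (hΦ k) (hΦ n)
  have i1 := (hΦ k).integrable_gradient_rpow hp
  have i2 := (hΦ n).integrable_gradient_rpow hp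
  have h1 : ∫ x in Ω, ‖gradient (Φ k) x - gradient (Φ n) x‖ ^ p ≤
      ε / (4 * (B + 1)) * ((∫ x in Ω, ‖gradient (Φ k) x‖ ^ p) +
        ∫ x in Ω, ‖gradient (Φ n) x‖ ^ p) +
      C * ∫ x in Ω, defect p (gradient (Φ k) x) (gradient (Φ n) x) := by
    have i3 : Integrable (fun x => ε / (4 * (B + 1)) *
      (‖gradient (Φ k) x‖ ^ p + ‖gradient (Φ n) x‖ ^ p)) (volume.restrict Ω) :=
      (i1.add i2).const_mul _
    rw [← integral_add i1 i2, ← integral_const_mul, ← integral_const_mul, ← integral_add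
      i3 (hi.const_mul _)]
    exact integral_mono (integrable_norm_rpow hp
      ((((hΦ k).memLp_gradient _).sub ((hΦ n).memLp_gradient _)).restrict Ω))
      (i3.add (hi.const_mul _)) fun x => hCab _ _
  have h2 : ε / (4 * (B + 1)) * ((∫ x in Ω, ‖gradient (Φ k) x‖ ^ p) +
        ∫ x in Ω, ‖gradient (Φ n) x‖ ^ p) ≤ ε / 2 := by
    calc _ ≤ ε / (4 * (B + 1)) * (B + B) := by gcongr <;> apply hB
      _ ≤ ε / 2 := by
        rw [div_mul_eq_mul_div, div_le_iff₀ (by positivity)]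
        nlinarith
  have h3 : C * ∫ x in Ω, defect p (gradient (Φ k) x) (gradient (Φ n) x) ≤ ε / 4 := by
    have h4 : ∫ x in Ω, defect p (gradient (Φ k) x) (gradient (Φ n) x) ≤
        p * (ε / (4 * (p * (C + 1)))) := by
      refine hle.trans ?_
      gcongr
      linarith [hN k hk, hN n hn]
    calc _ ≤ C * (p * (ε / (4 * (p * (C + 1))))) := by gcongr
      _ = ε / 4 * (C / (C + 1)) := by field_simp
      _ ≤ ε / 4 * 1 := by
        gcongr
        rw [div_le_one (by positivity)]
        linarith
      _ = _ := mul_one _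
  linarith

/-- Differentiation under the integral sign, with `|t| < 1` and the dominating function `p (|g| +
|w|)^(p-1) |w|`, integrable by Hölder's inequality. Since `p > 1`, `‖·‖ ^ p` is differentiable at
zero as well. This is the first variation from which the weak equation is read off. -/
theorem hasDerivAt_integral_norm_rpow {α V : Type*} [MeasurableSpace α] {μ : Measure α}
    [NormedAddCommGroup V] [InnerProductSpace ℝ V] (hp : 1 < p) {g w : α → V}
    (hg : MemLp g (ENNReal.ofReal p) μ) (hw : MemLp w (ENNReal.ofReal p) μ) :
    HasDerivAt (fun t : ℝ => ∫ x, ‖g x + t • w x‖ ^ p ∂μ)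
      (∫ x, p * (‖g x‖ ^ (p - 2) * inner ℝ (g x) (w x)) ∂μ) 0 := by
  have hpq := Real.HolderConjugate.conjExponent hp
  have hm : ∀ t : ℝ, MemLp (fun x => g x + t • w x) (ENNReal.ofReal p) μ :=
    fun t => hg.add (hw.const_smul t)
  have hb : MemLp (fun x => ‖g x‖ + ‖w x‖) (ENNReal.ofReal p) μ := hg.norm.add hw.norm
  have key := hasDerivAt_integral_of_dominated_loc_of_deriv_le (μ := μ) (x₀ := (0 : ℝ))
    (F := fun t x => ‖g x + t • w x‖ ^ p)
    (F' := fun t x => p * (‖g x + t • w x‖ ^ (p - 2) * inner ℝ (g x + t • w x) (w x)))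
    (s := Metric.ball 0 1)
    (bound := fun x => p * (‖‖g x‖ + ‖w x‖‖ ^ (p - 1) * ‖w x‖))
    (Metric.ball_mem_nhds _ one_pos)
    (Eventually.of_forall fun t => (integrable_norm_rpow hp (hm t)).aestronglyMeasurable)
    (integrable_norm_rpow hp (hm 0)) ?_ ?_ ?_ ?_
  · simpa using key.2
  · refine AEStronglyMeasurable.const_mul ?_ p
    refine AEStronglyMeasurable.mul ?_ ((hm 0).1.inner hw.1)
    exact ((hm 0).1.norm.aemeasurable.pow_const _).aestronglyMeasurable
  · refine Eventually.of_forall fun x t ht => ?_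
    have ht' : |t| ≤ 1 := by
      have := mem_ball_zero_iff.1 ht
      rw [Real.norm_eq_abs] at this
      exact this.le
    have h1 : ‖g x + t • w x‖ ≤ ‖g x‖ + ‖w x‖ := by
      refine (norm_add_le _ _).trans ?_
      rw [norm_smul, Real.norm_eq_abs]
      have := mul_le_mul_of_nonneg_right ht' (norm_nonneg (w x))
      linarith
    rw [norm_mul, norm_mul, Real.norm_of_nonneg (by linarith : 0 ≤ p),
      Real.norm_of_nonneg (by positivity : 0 ≤ ‖g x + t • w x‖ ^ (p - 2))]
    refine mul_le_mul_of_nonneg_left ?_ (by linarith)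
    calc _ ≤ ‖g x + t • w x‖ ^ (p - 2) * (‖g x + t • w x‖ * ‖w x‖) :=
          mul_le_mul_of_nonneg_left (norm_inner_le_norm _ _) (by positivity)
      _ ≤ ‖g x + t • w x‖ ^ (p - 1) * ‖w x‖ := by
          rw [← mul_assoc]
          refine mul_le_mul_of_nonneg_right ?_ (norm_nonneg _)
          by_cases h0 : ‖g x + t • w x‖ = 0
          · rw [h0, mul_zero]; positivity
          · rw [← Real.rpow_add_one h0]; ring_nf; rfl
      _ ≤ _ := by
          rw [Real.norm_of_nonneg (by positivity : 0 ≤ ‖g x‖ + ‖w x‖)]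
          exact mul_le_mul_of_nonneg_right
            (Real.rpow_le_rpow (norm_nonneg _) h1 (by linarith)) (norm_nonneg _)
  · refine Integrable.const_mul ?_ p
    exact integrable_bilin hpq (ContinuousLinearMap.mul ℝ ℝ) (memLp_norm_rpow_sub_one hpq hb)
      hw.norm
  · refine Eventually.of_forall fun x t _ => ?_
    have h1 : HasDerivAt (fun t : ℝ => g x + t • w x) (w x) t := by
      simpa using ((hasDerivAt_id t).smul_const (w x)).const_add (g x)
    have h2 := (hasFDerivAt_norm_rpow (g x + t • w x) hp).comp_hasDerivAt t h1
    refine h2.congr_deriv ?_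
    simp only [_root_.smul_apply, smul_eq_mul, innerSL_apply_apply, mul_assoc]

/-- Existence of the `p`-torsion function. -/
theorem exists_isTorsionFunction (hD : 0 < D) (hp : 1 < p) (hb : Bornology.IsBounded Ω) :
    ∃ u, IsTorsionFunction p Ω u := by
  have hp0 : 0 < p := by linarith
  have hpq := Real.HolderConjugate.conjExponent hp
  have hfin : IsFiniteMeasure (volume.restrict Ω) := ⟨by simpa using hb.measure_lt_top⟩
  obtain ⟨C, hC⟩ := exists_torsionEnergy_ge hD hp hb
  let S : Set ℝ := torsionEnergy p Ω '' {φ | IsTestFunction Ω φ}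
  have hSne : S.Nonempty := ⟨_, _, IsTestFunction.zero, rfl⟩
  have hSbdd : BddBelow S := by
    refine ⟨-C, ?_⟩
    rintro _ ⟨φ, hφ, rfl⟩
    have h0 : 0 ≤ (∫ x in Ω, ‖gradient φ x‖ ^ p) / (2 * p) :=
      div_nonneg (integral_nonneg fun x => by positivity) (by positivity)
    linarith [hC φ hφ]
  obtain ⟨s, hsanti, hs, hsS⟩ := exists_seq_tendsto_sInf hSne hSbdd
  choose Φ hΦ hΦs using hsS
  set m := sInf S
  have hm : ∀ φ, IsTestFunction Ω φ → m ≤ torsionEnergy p Ω φ :=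
    fun φ hφ => csInf_le hSbdd ⟨φ, hφ, rfl⟩
  have hlim : Tendsto (fun n => torsionEnergy p Ω (Φ n)) atTop (𝓝 m) := by simpa only [hΦs] using hs
  have hB : ∀ n, ∫ x in Ω, ‖gradient (Φ n) x‖ ^ p ≤ 2 * p * (s 0 + C) := by
    intro n
    have h1 := hC _ (hΦ n)
    rw [hΦs] at h1
    have h2 := hsanti (Nat.zero_le n)
    have h3 : (∫ x in Ω, ‖gradient (Φ n) x‖ ^ p) / (2 * p) ≤ s 0 + C := by linarith
    rw [div_le_iff₀ (by positivity)] at h3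
    linarith
  have hcg := fun ε hε => integral_cauchy_of_minimizing (ε := ε) hp hm hΦ hB hlim hε
  have hcu : ∀ ε > 0, ∃ N, ∀ k ≥ N, ∀ n ≥ N, ∫ x in Ω, ‖Φ k x - Φ n x‖ ^ p < ε := by
    intro ε hε
    obtain ⟨r, hr⟩ := hb.exists_norm_le
    have hr' : ∀ x ∈ Ω, ‖x‖ ≤ max r 0 := fun x hx => (hr x hx).trans (le_max_left _ _)
    set c := (p * max r 0 / D) ^ p with hc
    have hc0 : 0 ≤ c := by positivity
    obtain ⟨N, hN⟩ := hcg (ε / (c + 1)) (by positivity)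
    refine ⟨N, fun k hk n hn => ?_⟩
    -- The difference is a test function, so the Poincaré inequality transfers the Cauchy property
    -- from the gradients to the functions.
    have ht := (hΦ k).add ((hΦ n).const_mul (-1))
    have h1 := poincare hD hp (le_max_right r 0) hr' ht
    rw [← ht.setIntegral_norm_rpow hp, ← ht.setIntegral_norm_gradient_rpow hp] at h1
    simp only [gradient_sub_test (hΦ k) (hΦ n)] at h1
    simp only [neg_one_mul, ← sub_eq_add_neg] at h1
    have h2 := hN k hk n hn
    rw [lt_div_iff₀ (by positivity)] at h2
    have h3 : 0 ≤ ∫ x in Ω, ‖gradient (Φ k) x - gradient (Φ n) x‖ ^ p :=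
      integral_nonneg fun x => by positivity
    rw [← hc] at h1
    nlinarith
  obtain ⟨g, hg, hgl⟩ := exists_limit_of_integral_cauchy hp
    (fun n => ((hΦ n).memLp_gradient _).restrict Ω) hcg
  obtain ⟨u, hu, hul⟩ := exists_limit_of_integral_cauchy hp
    (fun n => ((hΦ n).memLp _).restrict Ω) hcu
  have hwg : IsWeakGradient Ω u g := by
    intro ψ hψ
    have l1 := tendsto_integral_bilin hpq (ContinuousLinearMap.lsmul ℝ ℝ).flip
      ((hψ.memLp_gradient _).restrict Ω) (fun n => ((hΦ n).memLp _).restrict Ω) hu hul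
    have l2 := tendsto_integral_bilin hpq (ContinuousLinearMap.lsmul ℝ ℝ)
      ((hψ.memLp _).restrict Ω) (fun n => ((hΦ n).memLp_gradient _).restrict Ω) hg hgl
    simp only [ContinuousLinearMap.flip_apply, ContinuousLinearMap.lsmul_apply] at l1 l2
    refine tendsto_nhds_unique l1 (l2.neg.congr fun n => ?_)
    exact ((hΦ n).isWeakGradient ψ hψ).symm
  refine ⟨u, g, ⟨⟨hu, hg, hwg⟩, Φ, hΦ, hul, hgl⟩, fun ψ hψ => ?_⟩
  have hui : Tendsto (fun n => ∫ x in Ω, Φ n x) atTop (𝓝 (∫ x in Ω, u x)) := by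
    simpa using tendsto_integral_bilin hpq (ContinuousLinearMap.mul ℝ ℝ)
      (memLp_const (1 : ℝ)) (fun n => ((hΦ n).memLp _).restrict Ω) hu hul
  -- `h t` is the energy of `u + t ψ`, obtained as the limit of the energies of the competitors `Φ n
  -- + t ψ`. Hence `h ≥ m = h 0`, and `h' 0 = 0` is the weak equation tested with `ψ`.
  let h : ℝ → ℝ := fun t => (1 / p) * (∫ x in Ω, ‖g x + t • gradient ψ x‖ ^ p) -
    ((∫ x in Ω, u x) + t * ∫ x in Ω, ψ x)
  have hlimt : ∀ t, Tendsto (fun n => torsionEnergy p Ω fun x => Φ n x + t * ψ x) atTop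
      (𝓝 (h t)) := by
    intro t
    have hl := tendsto_integral_norm_rpow (μ := volume.restrict Ω) hp
      (G := fun n x => gradient (Φ n) x + t • gradient ψ x)
      (g := fun x => g x + t • gradient ψ x)
      (fun n => (((hΦ n).memLp_gradient _).add ((hψ.memLp_gradient _).const_smul t)).restrict Ω)
      (hg.add (((hψ.memLp_gradient _).const_smul t).restrict Ω))
      (by simpa only [add_sub_add_right_eq_sub] using hgl)
    refine ((hl.const_mul (1 / p)).sub (hui.add_const (t * ∫ x in Ω, ψ x))).congr fun n => ?_
    unfold torsionEnergy
    rw [integral_add (hΦ n).integrable.restrict (hψ.integrable.restrict.const_mul t),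
      integral_const_mul]
    simp only [(hΦ n).gradient_add (hψ.const_mul t), gradient_const_mul']
  have h0 : h 0 = m := by
    refine tendsto_nhds_unique (hlimt 0) ?_
    simpa using hlim
  have hmin : IsLocalMin h 0 := Eventually.of_forall fun t => by
    rw [h0]
    exact ge_of_tendsto (hlimt t) (Eventually.of_forall fun n =>
      hm _ ((hΦ n).add (hψ.const_mul t)))
  have hd : HasDerivAt h ((1 / p) * (∫ x in Ω, p * (‖g x‖ ^ (p - 2) *
      inner ℝ (g x) (gradient ψ x))) - ∫ x in Ω, ψ x) 0 := by
    refine ((hasDerivAt_integral_norm_rpow hp hg ((hψ.memLp_gradient _).restrict Ω)).const_mul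
      (1 / p)).sub ?_
    simpa using ((hasDerivAt_id (0 : ℝ)).mul_const (∫ x in Ω, ψ x)).const_add (∫ x in Ω, u x)
  have := hmin.hasDerivAt_eq_zero hd
  rw [integral_const_mul, ← mul_assoc, one_div_mul_cancel hp0.ne', one_mul] at this
  linarith

end

/-! ### The rigidity as a best constant -/

section

variable {D : ℕ} {Ω : Set (E D)} {φ ψ : E D → ℝ} {p : ℝ}

/-- At `v = 0` both sides vanish because `p > 1`, whatever value the power with exponent `p - 2`
takes there. -/
theorem norm_rpow_smul_self {V : Type*} [NormedAddCommGroup V] [NormedSpace ℝ V] (hp : 1 < p)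
    (v : V) : ‖‖v‖ ^ (p - 2) • v‖ = ‖v‖ ^ (p - 1) := by
  rw [norm_smul, Real.norm_of_nonneg (by positivity)]
  by_cases h : ‖v‖ = 0
  · rw [h, mul_zero, Real.zero_rpow (by linarith)]
  · rw [← Real.rpow_add_one h]
    ring_nf

theorem memLp_norm_rpow_smul {α V : Type*} [MeasurableSpace α] {μ : Measure α}
    [NormedAddCommGroup V] [NormedSpace ℝ V] {q : ℝ} (hpq : p.HolderConjugate q) {g : α → V}
    (hg : MemLp g (ENNReal.ofReal p) μ) :
    MemLp (fun x => ‖g x‖ ^ (p - 2) • g x) (ENNReal.ofReal q) μ := by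
  refine (memLp_norm_rpow_sub_one hpq hg).of_le ?_ (Eventually.of_forall fun x => ?_)
  · exact (hg.1.norm.aemeasurable.pow_const _).aestronglyMeasurable.smul hg.1
  · rw [norm_rpow_smul_self hpq.lt, Real.norm_of_nonneg (by positivity)]

/-- The weak formulation for a torsion function extends to its own weak gradient. -/
theorem torsionFunction_data (hp : 1 < p) (hb : Bornology.IsBounded Ω) {u : E D → ℝ}
    (hu : IsTorsionFunction p Ω u) :
    ∃ g : E D → E D, MemLp g (ENNReal.ofReal p) (volume.restrict Ω) ∧
      (∫ x in Ω, ‖g x‖ ^ p) = ∫ x in Ω, u x ∧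
      (∀ φ, IsTestFunction Ω φ →
        ∫ x, φ x = ∫ x in Ω, inner ℝ (‖g x‖ ^ (p - 2) • g x) (gradient φ x)) ∧
      ∃ Φ : ℕ → E D → ℝ, (∀ n, IsTestFunction Ω (Φ n)) ∧
        Tendsto (fun n => ∫ x, Φ n x) atTop (𝓝 (∫ x in Ω, u x)) ∧
        Tendsto (fun n => ∫ x, ‖gradient (Φ n) x‖ ^ p) atTop (𝓝 (∫ x in Ω, ‖g x‖ ^ p)) := by
  have hpq := Real.HolderConjugate.conjExponent hp
  have hfin : IsFiniteMeasure (volume.restrict Ω) := ⟨by simpa using hb.measure_lt_top⟩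
  obtain ⟨g, ⟨⟨hu, hg, -⟩, Φ, hΦ, hul, hgl⟩, hEL⟩ := hu
  have hEL' : ∀ φ, IsTestFunction Ω φ →
      ∫ x, φ x = ∫ x in Ω, inner ℝ (‖g x‖ ^ (p - 2) • g x) (gradient φ x) := fun φ hφ => by
    rw [← hφ.setIntegral_eq, ← hEL φ hφ]
    simp only [real_inner_smul_left]
  have hui : Tendsto (fun n => ∫ x, Φ n x) atTop (𝓝 (∫ x in Ω, u x)) := by
    have := tendsto_integral_bilin hpq (ContinuousLinearMap.mul ℝ ℝ)
      (memLp_const (1 : ℝ)) (fun n => ((hΦ n).memLp _).restrict Ω) hu hul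
    simpa [fun n => (hΦ n).setIntegral_eq] using this
  have hgi := tendsto_integral_norm_rpow hp (fun n => ((hΦ n).memLp_gradient _).restrict Ω) hg hgl
  replace hgi := hgi.congr fun n => (hΦ n).setIntegral_norm_gradient_rpow hp
  refine ⟨g, hg, ?_, hEL', Φ, hΦ, hui, hgi⟩
  -- Testing with `Φ n` and letting `n → ∞` amounts to testing with `u` itself, which gives `∫ |g|^p
  -- = ∫ u`.
  have l1 : Tendsto
      (fun n => ∫ x in Ω, inner ℝ (‖g x‖ ^ (p - 2) • g x) (gradient (Φ n) x)) atTop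
      (𝓝 (∫ x in Ω, inner ℝ (‖g x‖ ^ (p - 2) • g x) (g x))) :=
    tendsto_integral_bilin hpq (innerSL ℝ) (memLp_norm_rpow_smul hpq hg)
      (fun n => ((hΦ n).memLp_gradient _).restrict Ω) hg hgl
  rw [tendsto_nhds_unique hui (l1.congr fun n => (hEL' _ (hΦ n)).symm)]
  refine integral_congr_ae (Eventually.of_forall fun x => ?_)
  simp only
  rw [real_inner_smul_left, real_inner_self_eq_norm_sq]
  by_cases h : ‖g x‖ = 0
  · rw [h, Real.zero_rpow (by linarith)]; simp
  · rw [← Real.rpow_natCast, ← Real.rpow_add (by positivity)]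
    norm_num

/-- The facts needed hold for any torsion function, so they apply to the one selected in the
definition and uniqueness plays no role. -/
theorem torsionalRigidity_data (hD : 0 < D) (hp : 1 < p) (hb : Bornology.IsBounded Ω) :
    ∃ g : E D → E D, MemLp g (ENNReal.ofReal p) (volume.restrict Ω) ∧
      (∫ x in Ω, ‖g x‖ ^ p) = torsionalRigidity p Ω ∧
      (∀ φ, IsTestFunction Ω φ →
        ∫ x, φ x = ∫ x in Ω, inner ℝ (‖g x‖ ^ (p - 2) • g x) (gradient φ x)) ∧
      ∃ Φ : ℕ → E D → ℝ, (∀ n, IsTestFunction Ω (Φ n)) ∧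
        Tendsto (fun n => ∫ x, Φ n x) atTop (𝓝 (torsionalRigidity p Ω)) ∧
        Tendsto (fun n => ∫ x, ‖gradient (Φ n) x‖ ^ p) atTop (𝓝 (torsionalRigidity p Ω)) := by
  have h := exists_isTorsionFunction hD hp hb
  have hT : torsionalRigidity p Ω = ∫ x in Ω, h.choose x := by
    rw [torsionalRigidity, dif_pos h]
  obtain ⟨g, hg, h1, h2, Φ, hΦ, h3, h4⟩ := torsionFunction_data hp hb h.choose_spec
  rw [h1] at h4
  rw [hT]
  exact ⟨g, hg, h1, h2, Φ, hΦ, h3, h4⟩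

theorem torsionalRigidity_nonneg (hD : 0 < D) (hp : 1 < p) (hb : Bornology.IsBounded Ω) :
    0 ≤ torsionalRigidity p Ω := by
  obtain ⟨g, -, h, -⟩ := torsionalRigidity_data hD hp hb
  rw [← h]
  exact integral_nonneg fun x => by positivity

/-- The torsional rigidity is an admissible constant in the torsion inequality. -/
theorem integral_le_torsionalRigidity (hD : 0 < D) (hp : 1 < p) (hb : Bornology.IsBounded Ω)
    (hφ : IsTestFunction Ω φ) :
    ∫ x, φ x ≤ torsionalRigidity p Ω ^ (1 - 1 / p) * (∫ x, ‖gradient φ x‖ ^ p) ^ (1 / p) := by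
  have hpq := Real.HolderConjugate.conjExponent hp
  obtain ⟨g, hg, h1, h2, -⟩ := torsionalRigidity_data hD hp hb
  have hφL := (hφ.memLp_gradient (ENNReal.ofReal p)).restrict Ω
  -- The weak equation turns `∫ φ` into the pairing of `|g|^(p-2) g` with `∇φ`. Cauchy–Schwarz
  -- pointwise, Hölder and `∫ |g|^p = T` give the inequality.
  rw [h2 φ hφ, ← h1, ← hφ.setIntegral_norm_gradient_rpow hp]
  refine le_trans ?_ (integral_norm_rpow_mul_le hp hg hφL.norm fun x => norm_nonneg _)
  refine integral_mono (integrable_bilin hpq (innerSL ℝ) (memLp_norm_rpow_smul hpq hg) hφL)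
    (integrable_bilin hpq (ContinuousLinearMap.mul ℝ ℝ) (memLp_norm_rpow_sub_one hpq hg)
      hφL.norm) fun x => ?_
  refine (real_inner_le_norm _ _).trans ?_
  rw [norm_rpow_smul_self hp]

/-- The torsional rigidity is the best constant in the torsion inequality. -/
theorem torsionalRigidity_rpow_le (hD : 0 < D) (hp : 1 < p) (hb : Bornology.IsBounded Ω)
    {K : ℝ} (hK : 0 ≤ K) (h : ∀ φ, IsTestFunction Ω φ →
      ∫ x, φ x ≤ K * (∫ x, ‖gradient φ x‖ ^ p) ^ (1 / p)) :
    torsionalRigidity p Ω ^ (1 - 1 / p) ≤ K := by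
  have hp0 : 0 < p := by linarith
  have h1p : 1 / p < 1 := by rw [div_lt_one hp0]; exact hp
  obtain ⟨g, -, -, -, Φ, hΦ, h3, h4⟩ := torsionalRigidity_data hD hp hb
  -- Along the approximating sequence both integrals tend to `T`, so the hypothesis becomes `T ≤ K
  -- T^(1/p)`; this can be divided unless `T = 0`.
  have h5 := le_of_tendsto_of_tendsto' h3
    ((h4.rpow_const (p := 1 / p) (Or.inr (by positivity))).const_mul K) fun n => h _ (hΦ n)
  rcases (torsionalRigidity_nonneg hD hp hb).eq_or_lt with h0 | h0
  · rw [← h0, Real.zero_rpow (by linarith)]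
    exact hK
  · rw [Real.rpow_sub h0, Real.rpow_one, div_le_iff₀ (by positivity)]
    exact h5

end

/-! ### The torsion inequality for Lipschitz functions -/

section

open scoped Convolution

variable {D : ℕ} {Ω : Set (E D)} {p : ℝ}

theorem locallyIntegrable_fderiv {f : E D → ℝ} {C : NNReal} (hf : LipschitzWith C f) :
    LocallyIntegrable (fderiv ℝ f) := by
  have hm : AEStronglyMeasurable (fderiv ℝ f) volume :=
    (measurable_fderiv ℝ f).aestronglyMeasurable
  exact (memLp_top_of_bound hm C
    (Eventually.of_forall fun x => norm_fderiv_le_of_lipschitz ℝ hf)).locallyIntegrable le_top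

/-- The derivative of the mollification of a Lipschitz function. -/
theorem hasFDerivAt_convolution_lipschitz (ρ : ContDiffBump (0 : E D)) {f : E D → ℝ} {C : NNReal}
    (hf : LipschitzWith C f) (x₀ : E D) :
    HasFDerivAt (ρ.normed volume ⋆[ContinuousLinearMap.lsmul ℝ ℝ, volume] f)
      ((ρ.normed volume ⋆[ContinuousLinearMap.lsmul ℝ ℝ, volume] fderiv ℝ f) x₀) x₀ := by
  have hρ : Continuous (ρ.normed volume) := ρ.continuous_normed
  have hρc : HasCompactSupport (ρ.normed volume) := ρ.hasCompactSupport_normed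
  have key := hasFDerivAt_integral_of_dominated_loc_of_lip (μ := (volume : Measure (E D)))
    (𝕜 := ℝ) (F := fun x t => ρ.normed volume t • f (x - t))
    (F' := fun t => ρ.normed volume t • fderiv ℝ f (x₀ - t)) (x₀ := x₀)
    (s := Metric.ball x₀ 1) (bound := fun t => ρ.normed volume t * C)
    (Metric.ball_mem_nhds _ one_pos) ?_ ?_ ?_ ?_ ?_ ?_
  · exact key.2
  · refine Eventually.of_forall fun x => Continuous.aestronglyMeasurable ?_
    have := hf.continuous
    fun_prop
  · refine Continuous.integrable_of_hasCompactSupport ?_ hρc.smul_right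
    have := hf.continuous
    fun_prop
  · refine hρ.aestronglyMeasurable.smul ?_
    exact ((measurable_fderiv ℝ f).comp (measurable_const.sub measurable_id)).aestronglyMeasurable
  · refine Eventually.of_forall fun t => ?_
    refine LipschitzOnWith.of_dist_le_mul fun x _ y _ => ?_
    rw [dist_eq_norm, ← smul_sub, norm_smul]
    have h1 := hf.dist_le_mul (x - t) (y - t)
    rw [dist_sub_right, dist_eq_norm] at h1
    have h2 := ρ.nonneg_normed (μ := volume) t
    rw [Real.norm_of_nonneg h2, Real.coe_nnabs, abs_of_nonneg (by positivity), mul_assoc]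
    gcongr
  · exact (hρ.integrable_of_hasCompactSupport hρc).mul_const _
  -- By Rademacher's theorem and invariance under reflection, `x ↦ f (x - t)` is differentiable at
  -- `x₀` for almost every `t`.
  · have h1 : ∀ᵐ y ∂(volume : Measure (E D)), DifferentiableAt ℝ f y := hf.ae_differentiableAt
    have h2 := (Measure.measurePreserving_sub_left (volume : Measure (E D)) x₀).quasiMeasurePreserving.ae h1
    filter_upwards [h2] with t ht
    have h3 : HasFDerivAt (fun x => f (x - t)) (fderiv ℝ f (x₀ - t)) x₀ :=
      ht.hasFDerivAt.comp x₀ (hasFDerivAt_sub_const t)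
    exact h3.const_smul (ρ.normed volume t)

theorem norm_convolution_fderiv_le (ρ : ContDiffBump (0 : E D)) {f : E D → ℝ} {C : NNReal}
    (hf : LipschitzWith C f) (x : E D) :
    ‖(ρ.normed volume ⋆[ContinuousLinearMap.lsmul ℝ ℝ, volume] fderiv ℝ f) x‖ ≤ C := by
  have hρi : Integrable (ρ.normed volume) (volume : Measure (E D)) :=
    ρ.continuous_normed.integrable_of_hasCompactSupport ρ.hasCompactSupport_normed
  calc _ ≤ ∫ t, ρ.normed volume t * C := by
        refine norm_integral_le_of_norm_le (hρi.mul_const _) (Eventually.of_forall fun t => ?_)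
        simp only [ContinuousLinearMap.lsmul_apply, norm_smul]
        rw [Real.norm_of_nonneg (ρ.nonneg_normed t)]
        have := ρ.nonneg_normed (μ := volume) t
        gcongr
        exact norm_fderiv_le_of_lipschitz ℝ hf
    _ = C := by rw [integral_mul_const, ρ.integral_normed, one_mul]

/-- The torsion inequality for Lipschitz functions with compact support in `Ω`. -/
theorem integral_le_of_lipschitz_of_tsupport (hD : 0 < D) (hp : 1 < p) (ho : IsOpen Ω)
    (hb : Bornology.IsBounded Ω) {f : E D → ℝ} {C : NNReal} (hf : LipschitzWith C f)
    (hc : HasCompactSupport f) (hs : tsupport f ⊆ Ω) :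
    ∫ x, f x ≤ torsionalRigidity p Ω ^ (1 - 1 / p) * (∫ x, ‖fderiv ℝ f x‖ ^ p) ^ (1 / p) := by
  have hp0 : 0 < p := by linarith
  obtain ⟨δ, hδ, hδΩ⟩ := hc.isCompact.exists_cthickening_subset_open ho hs
  have hr : ∀ n : ℕ, 0 < δ / 2 / (n + 1) := fun n => by positivity
  -- Outer radii at most `δ` keep the mollified supports inside `Ω`. The fixed ratio `2` of outer to
  -- inner radius is what almost everywhere convergence of the mollified derivatives requires.
  let ρ : ℕ → ContDiffBump (0 : E D) := fun n =>
    ⟨δ / 2 / (n + 1), 2 * (δ / 2 / (n + 1)), hr n, by linarith [hr n]⟩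
  have hrOut : ∀ n, (ρ n).rOut = 2 * (δ / 2 / (n + 1)) := fun n => rfl
  have hrle : ∀ n, (ρ n).rOut ≤ δ := fun n => by
    rw [hrOut, ← mul_div_assoc, mul_div_cancel₀ _ two_ne_zero]
    exact div_le_self hδ.le (by linarith [Nat.cast_nonneg (α := ℝ) n])
  let F : ℕ → E D → ℝ := fun n => (ρ n).normed volume ⋆[ContinuousLinearMap.lsmul ℝ ℝ, volume] f
  have hFsupp : ∀ n, tsupport (F n) ⊆ Metric.cthickening δ (tsupport f) := by
    intro n
    refine closure_minimal ?_ Metric.isClosed_cthickening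
    refine (support_convolution_subset _).trans ?_
    rintro _ ⟨a, ha, b, hb', rfl⟩
    rw [(ρ n).support_normed_eq] at ha
    refine Metric.mem_cthickening_of_dist_le (a + b) b δ _ (subset_tsupport f hb') ?_
    rw [dist_eq_norm, add_sub_cancel_right]
    exact (mem_ball_zero_iff.1 ha).le.trans (hrle n)
  have hKc : IsCompact (Metric.cthickening δ (tsupport f)) := hc.isCompact.cthickening
  have hF : ∀ n, IsTestFunction Ω (F n) := fun n => by
    refine ⟨?_, HasCompactSupport.of_support_subset_isCompact hKc
      ((subset_tsupport _).trans (hFsupp n)), (hFsupp n).trans hδΩ⟩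
    have h1 : ContDiff ℝ ∞ ((ρ n).normed (volume : Measure (E D))) := (ρ n).contDiff_normed
    have h2 : LocallyIntegrable f (volume : Measure (E D)) := hf.continuous.locallyIntegrable
    have h3 : HasCompactSupport ((ρ n).normed (volume : Measure (E D))) :=
      (ρ n).hasCompactSupport_normed
    exact h3.contDiff_convolution_left _ h1 h2
  have hFint : ∀ n, ∫ x, F n x = ∫ x, f x := by
    intro n
    have := integral_convolution (μ := (volume : Measure (E D))) (ν := volume)
      (ContinuousLinearMap.lsmul ℝ ℝ)
      (((ρ n).continuous_normed (μ := volume)).integrable_of_hasCompactSupport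
        (ρ n).hasCompactSupport_normed)
      (hf.continuous.integrable_of_hasCompactSupport hc)
    refine this.trans ?_
    rw [(ρ n).integral_normed]
    simp
  have hFd : ∀ n x, fderiv ℝ (F n) x =
      ((ρ n).normed volume ⋆[ContinuousLinearMap.lsmul ℝ ℝ, volume] fderiv ℝ f) x :=
    fun n x => (hasFDerivAt_convolution_lipschitz (ρ n) hf x).fderiv
  have hrlim : Tendsto (fun n => (ρ n).rOut) atTop (𝓝 0) := by
    have h1 : Tendsto (fun n : ℕ => δ * (1 / ((n : ℝ) + 1))) atTop (𝓝 (δ * 0)) :=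
      tendsto_one_div_add_atTop_nhds_zero_nat.const_mul δ
    rw [mul_zero] at h1
    refine h1.congr fun n => ?_
    rw [hrOut]
    ring
  have hae := ContDiffBump.ae_convolution_tendsto_right_of_locallyIntegrable
    (μ := (volume : Measure (E D))) (K := 2) hrlim
    (Eventually.of_forall fun n => le_refl _) (locallyIntegrable_fderiv hf)
  have hlim : Tendsto (fun n => ∫ x, ‖gradient (F n) x‖ ^ p) atTop
      (𝓝 (∫ x, ‖fderiv ℝ f x‖ ^ p)) := by
    refine tendsto_integral_of_dominated_convergence
      ((Metric.cthickening δ (tsupport f)).indicator fun _ => (C : ℝ) ^ p) (fun n => ?_) ?_ ?_ ?_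
    · exact ((hF n).continuous_gradient.norm.rpow_const
        fun _ => Or.inr hp0.le).aestronglyMeasurable
    · exact (integrable_indicator_iff hKc.measurableSet).2
        (integrableOn_const (hKc.measure_lt_top.ne))
    · intro n
      refine Eventually.of_forall fun x => ?_
      rw [Real.norm_of_nonneg (by positivity)]
      by_cases hx : x ∈ Metric.cthickening δ (tsupport f)
      · rw [Set.indicator_of_mem hx, norm_gradient, hFd]
        gcongr
        exact norm_convolution_fderiv_le _ hf x
      · rw [Set.indicator_of_notMem hx, gradient_eq_zero_of_notMem_tsupport
          fun h => hx (hFsupp n h), norm_zero, Real.zero_rpow hp0.ne']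
    · filter_upwards [hae] with x hx
      simp only [norm_gradient, hFd]
      exact hx.norm.rpow_const (Or.inr hp0.le)
  refine ge_of_tendsto ((hlim.rpow_const (p := 1 / p) (Or.inr (by positivity))).const_mul _)
    (Eventually.of_forall fun n => ?_)
  rw [← hFint n]
  exact integral_le_torsionalRigidity hD hp hb (hF n)

/-- On the level set `f = δ` the truncation attains its minimum, so its `fderiv` is zero there,
differentiable or not. -/
theorem norm_fderiv_posPart_sub_le {f : E D → ℝ} (δ : ℝ) {x : E D}
    (hx : DifferentiableAt ℝ f x) :
    ‖fderiv ℝ (fun y => max (f y - δ) 0) x‖ ≤ ‖fderiv ℝ f x‖ := by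
  rcases lt_trichotomy (f x) δ with h | h | h
  · have : (fun y => max (f y - δ) 0) =ᶠ[𝓝 x] fun _ => 0 := by
      filter_upwards [hx.continuousAt.eventually_lt_const h] with y hy
      exact max_eq_right (by linarith)
    rw [this.fderiv_eq]
    simp
  · have : IsLocalMin (fun y => max (f y - δ) 0) x := Eventually.of_forall fun y => by
      simp [h]
    rw [this.fderiv_eq_zero]
    simp
  · have : (fun y => max (f y - δ) 0) =ᶠ[𝓝 x] fun y => f y - δ := by
      filter_upwards [hx.continuousAt.eventually_const_lt h] with y hy
      exact max_eq_left (by linarith)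
    rw [this.fderiv_eq, fderiv_sub_const]

theorem integrable_norm_fderiv_rpow (hp : 1 < p) {f : E D → ℝ} {C : NNReal}
    (hf : LipschitzWith C f) (hc : HasCompactSupport f) :
    Integrable fun x => ‖fderiv ℝ f x‖ ^ p := by
  have hp0 : 0 < p := by linarith
  refine Integrable.mono' (g := (tsupport f).indicator fun _ => (C : ℝ) ^ p) ?_ ?_ ?_
  · exact (integrable_indicator_iff (isClosed_tsupport f).measurableSet).2
      (integrableOn_const hc.isCompact.measure_lt_top.ne)
  · exact ((measurable_fderiv ℝ f).norm.pow_const p).aestronglyMeasurable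
  · refine Eventually.of_forall fun x => ?_
    rw [Real.norm_of_nonneg (by positivity)]
    by_cases hx : x ∈ tsupport f
    · rw [Set.indicator_of_mem hx]
      gcongr
      exact norm_fderiv_le_of_lipschitz ℝ hf
    · rw [Set.indicator_of_notMem hx, fderiv_of_notMem_tsupport ℝ hx, norm_zero,
        Real.zero_rpow hp0.ne']

theorem hasCompactSupport_of_eq_zero (hb : Bornology.IsBounded Ω) {f : E D → ℝ}
    (h : ∀ x ∉ Ω, f x = 0) : HasCompactSupport f :=
  HasCompactSupport.of_support_subset_isCompact hb.isCompact_closure fun x hx =>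
    subset_closure (by by_contra h'; exact hx (h x h'))

/-- The torsion inequality for Lipschitz functions vanishing outside `Ω`. -/
theorem integral_le_of_lipschitz (hD : 0 < D) (hp : 1 < p) (ho : IsOpen Ω)
    (hb : Bornology.IsBounded Ω) {f : E D → ℝ} {C : NNReal} (hf : LipschitzWith C f)
    (hs : ∀ x ∉ Ω, f x = 0) :
    ∫ x, f x ≤ torsionalRigidity p Ω ^ (1 - 1 / p) * (∫ x, ‖fderiv ℝ f x‖ ^ p) ^ (1 / p) := by
  have hp0 : 0 < p := by linarith
  have hc := hasCompactSupport_of_eq_zero hb hs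
  have hT := torsionalRigidity_nonneg hD hp hb
  set R := torsionalRigidity p Ω ^ (1 - 1 / p) * (∫ x, ‖fderiv ℝ f x‖ ^ p) ^ (1 / p)
  have hfin : volume Ω ≠ ⊤ := hb.measure_lt_top.ne
  have key : ∀ δ : ℝ, 0 < δ → ∫ x, f x ≤ R + δ * volume.real Ω := by
    intro δ hδ
    -- Since `f` vanishes off `Ω`, the support of `(f - δ)₊` stays in `{f ≥ δ} ⊆ Ω`. The truncation
    -- loses at most `δ |Ω|` of the integral, and `δ → 0` at the end.
    let g : E D → ℝ := fun y => max (f y - δ) 0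
    have hgl : LipschitzWith C g := by
      have h1 : LipschitzWith C fun y => f y - δ := by
        refine LipschitzWith.of_dist_le_mul fun x y => ?_
        rw [dist_sub_right]
        exact hf.dist_le_mul x y
      exact h1.max_const 0
    have hgs : tsupport g ⊆ Ω := by
      have : tsupport g ⊆ {x | δ ≤ f x} := by
        refine closure_minimal (fun x hx => ?_) (isClosed_le continuous_const hf.continuous)
        by_contra h
        refine hx (max_eq_right ?_)
        simp only [Set.mem_ofPred_eq, not_le] at h
        linarith
      intro x hx
      by_contra h
      have h2 : δ ≤ f x := this hx
      rw [hs x h] at h2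
      linarith
    have hgc : HasCompactSupport g := by
      refine hasCompactSupport_of_eq_zero hb fun x hx => ?_
      simp only [g, hs x hx]
      exact max_eq_right (by linarith)
    have h1 := integral_le_of_lipschitz_of_tsupport hD hp ho hb hgl hgc hgs
    have h2 : ∫ x, ‖fderiv ℝ g x‖ ^ p ≤ ∫ x, ‖fderiv ℝ f x‖ ^ p := by
      refine integral_mono_ae (integrable_norm_fderiv_rpow hp hgl hgc)
        (integrable_norm_fderiv_rpow hp hf hc) ?_
      filter_upwards [hf.ae_differentiableAt (μ := volume)] with x hx
      exact Real.rpow_le_rpow (norm_nonneg _) (norm_fderiv_posPart_sub_le δ hx) hp0.le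
    have h3 : ∫ x, f x ≤ ∫ x, (g x + Ω.indicator (fun _ => δ) x) := by
      refine integral_mono (hf.continuous.integrable_of_hasCompactSupport hc)
        ((hgl.continuous.integrable_of_hasCompactSupport hgc).add
          ((integrable_indicator_iff ho.measurableSet).2 (integrableOn_const hfin)))
        fun x => ?_
      by_cases hx : x ∈ Ω
      · simp only [Set.indicator_of_mem hx]
        have := le_max_left (f x - δ) 0
        simp only [g]
        linarith
      · simp only [Set.indicator_of_notMem hx, hs x hx, add_zero]
        exact le_max_right _ _
    rw [integral_add (hgl.continuous.integrable_of_hasCompactSupport hgc)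
      ((integrable_indicator_iff ho.measurableSet).2 (integrableOn_const hfin)),
      integral_indicator ho.measurableSet, setIntegral_const, smul_eq_mul] at h3
    have h4 : torsionalRigidity p Ω ^ (1 - 1 / p) * (∫ x, ‖fderiv ℝ g x‖ ^ p) ^ (1 / p) ≤ R := by
      exact mul_le_mul_of_nonneg_left (Real.rpow_le_rpow
        (integral_nonneg fun x => by positivity) h2 (by positivity)) (by positivity)
    linarith
  have hlim : Tendsto (fun δ : ℝ => R + δ * volume.real Ω) (𝓝[>] 0) (𝓝 (R + 0 * volume.real Ω)) :=
    ((continuous_const.add (continuous_id.mul continuous_const)).tendsto 0).mono_left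
      nhdsWithin_le_nhds
  rw [zero_mul, add_zero] at hlim
  exact ge_of_tendsto hlim (eventually_nhdsWithin_of_forall fun δ hδ => key δ hδ)

end

/-! ### Distance to the complement and a Hardy-type inequality -/

section

variable {D : ℕ} {Ω : Set (E D)} {p : ℝ}

/-- Concavity of the distance to the complement, in the form of a supporting functional of
norm one. -/
theorem exists_unit_infDist_le (ho : IsOpen Ω) (hcv : Convex ℝ Ω) (hne : (Ωᶜ).Nonempty)
    {x : E D} (hx : x ∈ Ω) :
    ∃ ν : E D, ‖ν‖ = 1 ∧ ∀ z ∈ Ω,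
      Metric.infDist z Ωᶜ ≤ Metric.infDist x Ωᶜ - inner ℝ ν (z - x) := by
  -- A hyperplane through the point `y` of the complement nearest to `x` separates it from `Ω`; `ν`
  -- is its unit normal pointing away from `Ω`.
  obtain ⟨y, hy, hxy⟩ := ho.isClosed_compl.exists_infDist_eq_dist hne x
  obtain ⟨f, hf⟩ := geometric_hahn_banach_open_point hcv ho hy
  set w : E D := (InnerProductSpace.toDual ℝ (E D)).symm f with hw
  have hfw : ∀ z, f z = inner ℝ w z := fun z => by
    rw [hw, InnerProductSpace.toDual_symm_apply]
  have hw0 : 0 < ‖w‖ := by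
    rw [norm_pos_iff]
    intro h0
    have := hf x hx
    rw [hfw, hfw, h0, inner_zero_left, inner_zero_left] at this
    exact lt_irrefl _ this
  set ν : E D := ‖w‖⁻¹ • w with hν
  have hν1 : ‖ν‖ = 1 := by rw [hν, norm_smul, norm_inv, norm_norm, inv_mul_cancel₀ hw0.ne']
  have hsep : ∀ z ∈ Ω, inner ℝ ν z < inner ℝ ν y := by
    intro z hz
    have := hf z hz
    rw [hfw, hfw] at this
    rw [hν, real_inner_smul_left, real_inner_smul_left]
    gcongr
  -- The distance to the complement is at most the distance to the hyperplane: otherwise the foot `z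
  -- + s ν` would lie in `Ω`.
  have hle : ∀ z ∈ Ω, Metric.infDist z Ωᶜ ≤ inner ℝ ν (y - z) := by
    intro z hz
    by_contra! hlt
    have hs : 0 < inner ℝ ν (y - z) := by
      rw [inner_sub_right]
      linarith [hsep z hz]
    set s := inner ℝ ν (y - z) with hsdef
    have hmem : z + s • ν ∈ Ω := by
      refine Metric.ball_infDist_compl_subset (x := z) ?_
      rw [Metric.mem_ball, dist_eq_norm, add_sub_cancel_left, norm_smul, hν1, mul_one,
        Real.norm_of_nonneg hs.le]
      exact hlt
    have := hsep _ hmem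
    rw [inner_add_right, real_inner_smul_right, real_inner_self_eq_norm_sq, hν1, hsdef,
      inner_sub_right] at this
    linarith
  refine ⟨ν, hν1, fun z hz => (hle z hz).trans ?_⟩
  have h1 : inner ℝ ν (y - x) ≤ Metric.infDist x Ωᶜ := by
    rw [hxy, dist_comm, dist_eq_norm]
    simpa [hν1] using real_inner_le_norm ν (y - x)
  have h2 : y - z = (y - x) - (z - x) := by abel
  rw [h2, inner_sub_right]
  linarith

/-- Half the squared distance to the level `c` of the distance to the complement of `Ω`. -/
def halfSqDist (c : ℝ) (Ω : Set (E D)) (x : E D) : ℝ := (c - Metric.infDist x Ωᶜ) ^ 2 / 2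

/-- Difference of squares, together with the distance being 1-Lipschitz. Keeping the factor `c -
d(x)`, rather than a global constant, yields the pointwise gradient bound that becomes the Hardy
weight. -/
theorem abs_halfSqDist_sub_le {c : ℝ} (hc : ∀ x, Metric.infDist x Ωᶜ ≤ c) (x y : E D) :
    |halfSqDist c Ω y - halfSqDist c Ω x| ≤
      (c - Metric.infDist x Ωᶜ + ‖y - x‖ / 2) * ‖y - x‖ := by
  unfold halfSqDist
  set a := Metric.infDist x Ωᶜ
  set b := Metric.infDist y Ωᶜ
  have ha := hc x
  have hb := hc y
  have h1 : |b - a| ≤ ‖y - x‖ := by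
    have := (Metric.lipschitz_infDist_pt Ωᶜ).dist_le_mul y x
    rw [NNReal.coe_one, one_mul, Real.dist_eq, dist_eq_norm] at this
    exact this
  have h2 : (c - b) ^ 2 / 2 - (c - a) ^ 2 / 2 = ((c - a) + (c - b)) / 2 * (a - b) := by ring
  have h3 := abs_le.1 h1
  have h4 : 0 ≤ c - a := sub_nonneg.2 ha
  have h5 : 0 ≤ c - b := sub_nonneg.2 hb
  rw [h2, abs_mul, abs_of_nonneg (by positivity), abs_sub_comm]
  gcongr
  linarith

theorem lipschitzWith_halfSqDist {c : ℝ} (hc : ∀ x, Metric.infDist x Ωᶜ ≤ c) :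
    LipschitzWith c.toNNReal (halfSqDist c Ω) := by
  have hc0 : 0 ≤ c := Metric.infDist_nonneg.trans (hc 0)
  refine LipschitzWith.of_dist_le_mul fun y x => ?_
  rw [Real.dist_eq, dist_eq_norm, Real.coe_toNNReal c hc0]
  unfold halfSqDist
  set a := Metric.infDist x Ωᶜ
  set b := Metric.infDist y Ωᶜ
  have ha := hc x
  have hb := hc y
  have ha0 : 0 ≤ a := Metric.infDist_nonneg
  have hb0 : 0 ≤ b := Metric.infDist_nonneg
  have h1 : |b - a| ≤ ‖y - x‖ := by
    have := (Metric.lipschitz_infDist_pt Ωᶜ).dist_le_mul y x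
    rw [NNReal.coe_one, one_mul, Real.dist_eq, dist_eq_norm] at this
    exact this
  have h2 : (c - b) ^ 2 / 2 - (c - a) ^ 2 / 2 = ((c - a) + (c - b)) / 2 * (a - b) := by ring
  have h4 : 0 ≤ c - a := sub_nonneg.2 ha
  have h5 : 0 ≤ c - b := sub_nonneg.2 hb
  rw [h2, abs_mul, abs_of_nonneg (by positivity), abs_sub_comm]
  gcongr
  linarith

theorem norm_fderiv_halfSqDist_le {c : ℝ} (hc : ∀ x, Metric.infDist x Ωᶜ ≤ c) {x : E D}
    (hx : DifferentiableAt ℝ (halfSqDist c Ω) x) :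
    ‖fderiv ℝ (halfSqDist c Ω) x‖ ≤ c - Metric.infDist x Ωᶜ := by
  refine le_of_forall_pos_le_add fun η hη => ?_
  refine hx.hasFDerivAt.le_of_lip' (by linarith [hc x]) ?_
  filter_upwards [Metric.ball_mem_nhds x hη] with y hy
  rw [Metric.mem_ball, dist_eq_norm] at hy
  rw [Real.norm_eq_abs]
  refine (abs_halfSqDist_sub_le hc x y).trans ?_
  gcongr
  linarith [norm_nonneg (y - x)]

theorem sum_inner_single_sq (ν : E D) :
    ∑ i, inner ℝ ν (EuclideanSpace.single i (1 : ℝ)) ^ 2 = ‖ν‖ ^ 2 := by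
  rw [EuclideanSpace.norm_sq_eq]
  refine Finset.sum_congr rfl fun i _ => ?_
  rw [EuclideanSpace.inner_single_right]
  simp

/-- `halfSqDist` has (discrete) Laplacian at least one. -/
theorem sq_le_sum_second_difference (ho : IsOpen Ω) (hcv : Convex ℝ Ω) (hne : (Ωᶜ).Nonempty)
    {c h : ℝ} (hh : 0 ≤ h) (hc : ∀ x, Metric.infDist x Ωᶜ + h ≤ c) {x : E D}
    (hx : Metric.closedBall x h ⊆ Ω) :
    h ^ 2 ≤ ∑ i : Fin D, (halfSqDist c Ω (x + h • EuclideanSpace.single i (1 : ℝ)) +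
      halfSqDist c Ω (x - h • EuclideanSpace.single i (1 : ℝ)) - 2 * halfSqDist c Ω x) := by
  obtain ⟨ν, hν, hle⟩ := exists_unit_infDist_le ho hcv hne (hx (Metric.mem_closedBall_self hh))
  -- One normal `ν` serves all axes, and the squares of its components add up to `1`.
  have key : ∀ i : Fin D, h ^ 2 * inner ℝ ν (EuclideanSpace.single i (1 : ℝ)) ^ 2 ≤
      halfSqDist c Ω (x + h • EuclideanSpace.single i (1 : ℝ)) +
      halfSqDist c Ω (x - h • EuclideanSpace.single i (1 : ℝ)) - 2 * halfSqDist c Ω x := by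
    intro i
    set e : E D := EuclideanSpace.single i (1 : ℝ)
    have he : ‖e‖ = 1 := by simp [e]
    set t := inner ℝ ν e with ht
    have ht1 : |t| ≤ 1 := by simpa [hν, he] using abs_real_inner_le_norm ν e
    have h1 := hle (x + h • e) (hx (by
      rw [Metric.mem_closedBall, dist_eq_norm, add_sub_cancel_left, norm_smul, he, mul_one,
        Real.norm_of_nonneg hh]))
    have h2 := hle (x - h • e) (hx (by
      rw [Metric.mem_closedBall, dist_eq_norm, sub_sub_cancel_left, norm_neg, norm_smul, he,
        mul_one, Real.norm_of_nonneg hh]))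
    rw [add_sub_cancel_left, real_inner_smul_right, ← ht] at h1
    rw [sub_sub_cancel_left, inner_neg_right, real_inner_smul_right, ← ht] at h2
    unfold halfSqDist
    have hA := hc x
    set a := Metric.infDist x Ωᶜ
    set b := Metric.infDist (x + h • e) Ωᶜ
    set b' := Metric.infDist (x - h • e) Ωᶜ
    have h3 : |h * t| ≤ h := by
      rw [abs_mul, abs_of_nonneg hh]
      nlinarith
    obtain ⟨h4, h5⟩ := abs_le.1 h3
    -- Squaring needs `c - a ± h t ≥ 0`, which is why the level `c` exceeds every distance by at
    -- least `h`.
    have h6 : (c - a + h * t) ^ 2 ≤ (c - b) ^ 2 := pow_le_pow_left₀ (by linarith) (by linarith) 2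
    have h7 : (c - a - h * t) ^ 2 ≤ (c - b') ^ 2 := pow_le_pow_left₀ (by linarith) (by linarith) 2
    nlinarith
  refine le_trans (le_of_eq ?_) (Finset.sum_le_sum fun i _ => key i)
  rw [← Finset.mul_sum, sum_inner_single_sq, hν]
  ring

/-- Summation by parts for second differences. -/
theorem integral_mul_second_difference {f ψ : E D → ℝ} (hf : Continuous f)
    (hc : HasCompactSupport f) (hψ : Continuous ψ) (v : E D) :
    ∫ x, f x * (ψ (x + v) + ψ (x - v) - 2 * ψ x) =
      -∫ x, (f (x + v) - f x) * (ψ (x + v) - ψ x) := by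
  have i1 : Integrable fun x => f x * (ψ (x + v) - ψ x) :=
    (by fun_prop : Continuous fun x => f x * (ψ (x + v) - ψ x)).integrable_of_hasCompactSupport
      hc.mul_right
  have i2 : Integrable fun x => f x * (ψ x - ψ (x - v)) :=
    (by fun_prop : Continuous fun x => f x * (ψ x - ψ (x - v))).integrable_of_hasCompactSupport
      hc.mul_right
  have i3 : Integrable fun x => f (x + v) * (ψ (x + v) - ψ x) := by
    simpa using i2.comp_add_right v
  have h1 : ∫ x, f (x + v) * (ψ (x + v) - ψ x) = ∫ x, f x * (ψ x - ψ (x - v)) := by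
    rw [← integral_add_right_eq_self (fun x => f x * (ψ x - ψ (x - v))) v]
    simp
  have h2 : ∀ x, f x * (ψ (x + v) + ψ (x - v) - 2 * ψ x) =
      f x * (ψ (x + v) - ψ x) - f x * (ψ x - ψ (x - v)) := fun x => by ring
  have h3 : ∀ x, (f (x + v) - f x) * (ψ (x + v) - ψ x) =
      f (x + v) * (ψ (x + v) - ψ x) - f x * (ψ (x + v) - ψ x) := fun x => by ring
  simp only [h2, h3]
  rw [integral_sub i1 i2, integral_sub i3 i1, h1]
  ring

theorem tendsto_slope_lipschitz {f : E D → ℝ} {x : E D} (hf : DifferentiableAt ℝ f x) (v : E D)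
    {h : ℕ → ℝ} (hh : ∀ n, 0 < h n) (hlim : Tendsto h atTop (𝓝 0)) :
    Tendsto (fun n => (h n)⁻¹ * (f (x + h n • v) - f x)) atTop (𝓝 (fderiv ℝ f x v)) := by
  have h1 := (hf.hasFDerivAt.hasLineDerivAt v).tendsto_slope_zero_right
  have h2 : Tendsto h atTop (𝓝[>] 0) :=
    tendsto_nhdsWithin_iff.2 ⟨hlim, Eventually.of_forall hh⟩
  exact h1.comp h2

/-- Convergence of products of difference quotients of Lipschitz functions. -/
theorem tendsto_integral_mul_slope {f ψ : E D → ℝ} {C C' : NNReal} (hf : LipschitzWith C f)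
    (hc : HasCompactSupport f) (hψ : LipschitzWith C' ψ) {v : E D} (hv : ‖v‖ = 1)
    {h : ℕ → ℝ} (hh : ∀ n, 0 < h n) (hh1 : ∀ n, h n ≤ 1) (hlim : Tendsto h atTop (𝓝 0)) :
    Tendsto (fun n => ∫ x, ((h n)⁻¹ * (f (x + h n • v) - f x)) *
      ((h n)⁻¹ * (ψ (x + h n • v) - ψ x))) atTop (𝓝 (∫ x, fderiv ℝ f x v * fderiv ℝ ψ x v)) := by
  have hK : IsCompact (Metric.cthickening 1 (tsupport f)) := hc.isCompact.cthickening
  have hsl : ∀ {g : E D → ℝ} {B : NNReal}, LipschitzWith B g → ∀ n x,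
      |(h n)⁻¹ * (g (x + h n • v) - g x)| ≤ B := by
    intro g B hg n x
    have := hg.dist_le_mul (x + h n • v) x
    rw [Real.dist_eq, dist_eq_norm, add_sub_cancel_left, norm_smul, hv, mul_one,
      Real.norm_of_nonneg (hh n).le] at this
    rw [abs_mul, abs_of_pos (inv_pos.2 (hh n)), inv_mul_le_iff₀ (hh n), mul_comm]
    exact this
  refine tendsto_integral_of_dominated_convergence
    ((Metric.cthickening 1 (tsupport f)).indicator fun _ => (C : ℝ) * C') (fun n => ?_) ?_ ?_ ?_
  · have h1 := hf.continuous
    have h2 := hψ.continuous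
    exact Continuous.aestronglyMeasurable (by fun_prop)
  · exact (integrable_indicator_iff hK.measurableSet).2 (integrableOn_const hK.measure_lt_top.ne)
  · refine fun n => Eventually.of_forall fun x => ?_
    by_cases hx : x ∈ Metric.cthickening 1 (tsupport f)
    · rw [Set.indicator_of_mem hx, Real.norm_eq_abs, abs_mul]
      gcongr
      · exact hsl hf n x
      · exact hsl hψ n x
    · have h1 : f x = 0 := image_eq_zero_of_notMem_tsupport fun h' =>
        hx (Metric.self_subset_cthickening _ h')
      have h2 : f (x + h n • v) = 0 := image_eq_zero_of_notMem_tsupport fun h' => by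
        refine hx (Metric.mem_cthickening_of_dist_le x _ 1 _ h' ?_)
        rw [dist_eq_norm, sub_add_cancel_left, norm_neg, norm_smul, hv, mul_one,
          Real.norm_of_nonneg (hh n).le]
        exact hh1 n
      rw [Set.indicator_of_notMem hx, h1, h2]
      simp
  · filter_upwards [hf.ae_differentiableAt (μ := volume), hψ.ae_differentiableAt (μ := volume)]
      with x h1 h2
    exact (tendsto_slope_lipschitz h1 v hh hlim).mul (tendsto_slope_lipschitz h2 v hh hlim)

/-- The sum is the inner product of the Riesz representatives, so this is Cauchy–Schwarz. -/
theorem abs_sum_fderiv_single_mul_le (L L' : E D →L[ℝ] ℝ) :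
    |∑ i : Fin D, L (EuclideanSpace.single i 1) * L' (EuclideanSpace.single i 1)| ≤
      ‖L‖ * ‖L'‖ := by
  set a := (InnerProductSpace.toDual ℝ (E D)).symm L with ha
  set b := (InnerProductSpace.toDual ℝ (E D)).symm L' with hb
  have h1 : ∀ v, L v = inner ℝ a v := fun v => by rw [ha, InnerProductSpace.toDual_symm_apply]
  have h2 : ∀ v, L' v = inner ℝ b v := fun v => by rw [hb, InnerProductSpace.toDual_symm_apply]
  have h3 : ‖L‖ = ‖a‖ := by rw [ha, LinearIsometryEquiv.norm_map]
  have h4 : ‖L'‖ = ‖b‖ := by rw [hb, LinearIsometryEquiv.norm_map]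
  rw [h3, h4]
  refine le_trans (le_of_eq ?_) (abs_real_inner_le_norm a b)
  rw [PiLp.inner_apply]
  congr 1
  refine Finset.sum_congr rfl fun i _ => ?_
  rw [h1, h2, EuclideanSpace.inner_single_right, EuclideanSpace.inner_single_right]
  simp [mul_comm]

/-- A Hardy-type inequality on convex sets: `∫ f ≤ ∫ |∇f| (R - d)` where `d` is the distance to
the complement and `R` bounds `d`. -/
theorem integral_le_integral_fderiv_mul (ho : IsOpen Ω) (hcv : Convex ℝ Ω)
    (hne : (Ωᶜ).Nonempty) {R : ℝ} (hR : ∀ x, Metric.infDist x Ωᶜ ≤ R)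
    {f : E D → ℝ} {C : NNReal} (hf : LipschitzWith C f) (hc : HasCompactSupport f)
    (hs : tsupport f ⊆ Ω) (h0 : ∀ x, 0 ≤ f x) :
    ∫ x, f x ≤ ∫ x, ‖fderiv ℝ f x‖ * (R - Metric.infDist x Ωᶜ) := by
  have hfi : Integrable f := hf.continuous.integrable_of_hasCompactSupport hc
  have hfd : Integrable fun x => ‖fderiv ℝ f x‖ := by
    have hm : AEStronglyMeasurable (fderiv ℝ f) volume :=
      (measurable_fderiv ℝ f).aestronglyMeasurable
    refine Integrable.mono' (g := (tsupport f).indicator fun _ => (C : ℝ))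
      ((integrable_indicator_iff (isClosed_tsupport f).measurableSet).2
      (integrableOn_const hc.isCompact.measure_lt_top.ne)) hm.norm (Eventually.of_forall fun x => ?_)
    rw [norm_norm]
    by_cases hx : x ∈ tsupport f
    · rw [Set.indicator_of_mem hx]
      exact norm_fderiv_le_of_lipschitz ℝ hf
    · rw [Set.indicator_of_notMem hx, fderiv_of_notMem_tsupport ℝ hx, norm_zero]
  have hdc : Continuous fun x : E D => Metric.infDist x Ωᶜ := Metric.continuous_infDist_pt _
  have hint : ∀ c : ℝ, (∀ x, Metric.infDist x Ωᶜ ≤ c) →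
      Integrable fun x => ‖fderiv ℝ f x‖ * (c - Metric.infDist x Ωᶜ) := by
    intro c hc'
    refine hfd.mul_bdd (c := c) (continuous_const.sub hdc).aestronglyMeasurable
      (Eventually.of_forall fun x => ?_)
    rw [Real.norm_of_nonneg (by linarith [hc' x])]
    linarith [Metric.infDist_nonneg (x := x) (s := Ωᶜ)]
  -- Raising the level to `R + ε` leaves room for the increments of the second differences.
  have key : ∀ ε > 0, ∫ x, f x ≤ ∫ x, ‖fderiv ℝ f x‖ * (R + ε - Metric.infDist x Ωᶜ) := by
    intro ε hε
    obtain ⟨δ, hδ, hδΩ⟩ := hc.isCompact.exists_cthickening_subset_open ho hs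
    have hRε : ∀ x, Metric.infDist x Ωᶜ ≤ R + ε := fun x => by linarith [hR x]
    set ψ : E D → ℝ := halfSqDist (R + ε) Ω with hψdef
    have hψ := lipschitzWith_halfSqDist hRε
    -- Steps are at most `ε` for the room below the level, at most `δ` so that closed balls about
    -- the support stay in `Ω`, and at most `1` for the domination of the difference quotients.
    set m := min (min ε δ) 1 with hm
    have hm0 : 0 < m := lt_min (lt_min hε hδ) one_pos
    let h : ℕ → ℝ := fun n => m * (1 / ((n : ℝ) + 1))
    have hh : ∀ n, 0 < h n := fun n => by positivity
    have hhm : ∀ n, h n ≤ m := fun n => by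
      refine mul_le_of_le_one_right hm0.le ?_
      rw [div_le_one (by positivity)]
      linarith [Nat.cast_nonneg (α := ℝ) n]
    have hlim : Tendsto h atTop (𝓝 0) := by
      have := (tendsto_one_div_add_atTop_nhds_zero_nat (𝕜 := ℝ)).const_mul m
      rwa [mul_zero] at this
    let e : Fin D → E D := fun i => EuclideanSpace.single i 1
    have he : ∀ i, ‖e i‖ = 1 := fun i => by simp [e]
    -- The discrete form of `Δψ ≥ 1` multiplied by `f ≥ 0` and summed by parts. Second derivatives
    -- of `ψ` never appear; only first difference quotients pass to the limit.
    have hstep : ∀ n, ∫ x, f x ≤ -∑ i, ∫ x, ((h n)⁻¹ * (f (x + h n • e i) - f x)) *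
        ((h n)⁻¹ * (ψ (x + h n • e i) - ψ x)) := by
      intro n
      have h1 : ∀ x, h n ^ 2 * f x ≤
          ∑ i, f x * (ψ (x + h n • e i) + ψ (x - h n • e i) - 2 * ψ x) := by
        intro x
        rw [← Finset.mul_sum, mul_comm]
        by_cases hx : x ∈ tsupport f
        · refine mul_le_mul_of_nonneg_left ?_ (h0 x)
          refine sq_le_sum_second_difference ho hcv hne (hh n).le (fun y => ?_) ?_
          · have := (hhm n).trans ((min_le_left _ _).trans (min_le_left _ _))
            linarith [hR y]
          · intro y hy
            refine hδΩ (Metric.mem_cthickening_of_dist_le y x δ _ hx ?_)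
            exact (Metric.mem_closedBall.1 hy).trans
              ((hhm n).trans ((min_le_left _ _).trans (min_le_right _ _)))
        · rw [image_eq_zero_of_notMem_tsupport hx, zero_mul, zero_mul]
      have hψc : Continuous ψ := hψ.continuous
      have hfc : Continuous f := hf.continuous
      have i1 : ∀ i, Integrable fun x =>
          f x * (ψ (x + h n • e i) + ψ (x - h n • e i) - 2 * ψ x) := fun i =>
        (by fun_prop : Continuous fun x => f x * (ψ (x + h n • e i) + ψ (x - h n • e i) - 2 * ψ x)
          ).integrable_of_hasCompactSupport hc.mul_right
      have h2 := integral_mono (hfi.const_mul (h n ^ 2))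
        (integrable_finsetSum Finset.univ fun i _ => i1 i) h1
      rw [integral_const_mul, integral_finsetSum _ fun i _ => i1 i] at h2
      simp only [integral_mul_second_difference hfc hc hψc] at h2
      have h3 : ∀ i, ∫ x, ((h n)⁻¹ * (f (x + h n • e i) - f x)) *
          ((h n)⁻¹ * (ψ (x + h n • e i) - ψ x)) = (h n ^ 2)⁻¹ *
          ∫ x, (f (x + h n • e i) - f x) * (ψ (x + h n • e i) - ψ x) := by
        intro i
        rw [← integral_const_mul]
        congr 1
        ext x
        rw [sq, mul_inv]
        ring
      simp only [h3]
      rw [← Finset.mul_sum, ← mul_neg, ← Finset.sum_neg_distrib, inv_mul_eq_div,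
        le_div_iff₀ (pow_pos (hh n) 2), mul_comm]
      exact h2
    have hlim2 : Tendsto (fun n => -∑ i, ∫ x, ((h n)⁻¹ * (f (x + h n • e i) - f x)) *
        ((h n)⁻¹ * (ψ (x + h n • e i) - ψ x))) atTop
        (𝓝 (-∑ i, ∫ x, fderiv ℝ f x (e i) * fderiv ℝ ψ x (e i))) :=
      (tendsto_finsetSum _ fun i _ => tendsto_integral_mul_slope hf hc hψ (he i) hh
        (fun n => (hhm n).trans (min_le_right _ _)) hlim).neg
    refine (ge_of_tendsto' hlim2 hstep).trans ?_
    have i2 : ∀ i, Integrable fun x => fderiv ℝ f x (e i) * fderiv ℝ ψ x (e i) := by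
      intro i
      refine Integrable.mul_bdd (c := ((R + ε).toNNReal : ℝ)) ?_
        (measurable_fderiv_apply_const ℝ ψ (e i)).aestronglyMeasurable
        (Eventually.of_forall fun x => ?_)
      · refine hfd.mono' (measurable_fderiv_apply_const ℝ f (e i)).aestronglyMeasurable
          (Eventually.of_forall fun x => ?_)
        simpa [he i] using (fderiv ℝ f x).le_opNorm (e i)
      · have h1 := (fderiv ℝ ψ x).le_opNorm (e i)
        rw [he, mul_one] at h1
        exact h1.trans (norm_fderiv_le_of_lipschitz ℝ hψ)
    rw [← integral_finsetSum _ fun i _ => i2 i, ← integral_neg]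
    refine integral_mono_ae (integrable_finsetSum _ fun i _ => i2 i).neg (hint _ hRε) ?_
    filter_upwards [hψ.ae_differentiableAt (μ := volume)] with x hx
    refine (neg_le_abs _).trans ((abs_sum_fderiv_single_mul_le _ _).trans ?_)
    gcongr
    exact norm_fderiv_halfSqDist_le hRε hx
  have hlim : Tendsto (fun ε : ℝ => (∫ x, ‖fderiv ℝ f x‖ * (R - Metric.infDist x Ωᶜ)) +
      ε * ∫ x, ‖fderiv ℝ f x‖) (𝓝[>] 0)
      (𝓝 ((∫ x, ‖fderiv ℝ f x‖ * (R - Metric.infDist x Ωᶜ)) + 0 * ∫ x, ‖fderiv ℝ f x‖)) :=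
    ((continuous_const.add (continuous_id.mul continuous_const)).tendsto 0).mono_left
      nhdsWithin_le_nhds
  rw [zero_mul, add_zero] at hlim
  refine ge_of_tendsto hlim (eventually_nhdsWithin_of_forall fun ε hε => (key ε hε).trans ?_)
  rw [← integral_const_mul, ← integral_add (hint R hR) (hfd.const_mul ε)]
  refine le_of_eq (integral_congr_ae (Eventually.of_forall fun x => ?_))
  simp only
  ring

end

section

variable {D : ℕ} {Ω : Set (E D)} {p : ℝ}

/-! ### Gauges -/

/-- `J` is the gauge of `Ω` with respect to the centre `x₀`. -/
structure IsGaugeAt (Ω : Set (E D)) (x₀ : E D) (J : E D → ℝ) : Prop where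
  nonneg : ∀ x, 0 ≤ J x
  lt_one_iff : ∀ x, J x < 1 ↔ x ∈ Ω
  map_smul : ∀ t : ℝ, 0 < t → ∀ v, J (x₀ + t • v) = t * J (x₀ + v)

theorem IsGaugeAt.setOf_lt {x₀ : E D} {J : E D → ℝ} (h : IsGaugeAt Ω x₀ J) {t : ℝ} (ht : 0 < t) :
    {x | J x < t} = AffineMap.homothety x₀ t '' Ω := by
  ext x
  constructor
  · intro hx
    refine ⟨x₀ + t⁻¹ • (x - x₀), (h.lt_one_iff _).1 ?_, ?_⟩
    · rw [h.map_smul _ (inv_pos.2 ht), add_sub_cancel, inv_mul_lt_iff₀ ht, mul_one]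
      exact hx
    · simp [AffineMap.homothety_apply, smul_smul, mul_inv_cancel₀ ht.ne']
  · rintro ⟨y, hy, rfl⟩
    have h1 : AffineMap.homothety x₀ t y = x₀ + t • (y - x₀) := by
      simp [AffineMap.homothety_apply, add_comm]
    change J (AffineMap.homothety x₀ t y) < t
    rw [h1, h.map_smul _ ht, add_sub_cancel]
    exact mul_lt_of_lt_one_right ht ((h.lt_one_iff y).2 hy)

theorem IsGaugeAt.volume_lt {x₀ : E D} {J : E D → ℝ} (h : IsGaugeAt Ω x₀ J) {t : ℝ}
    (ht : 0 < t) : volume.real {x | J x < t} = t ^ D * volume.real Ω := by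
  rw [h.setOf_lt ht, measureReal_def, Measure.addHaar_image_homothety, ENNReal.toReal_mul,
    ENNReal.toReal_ofReal (abs_nonneg _), finrank_euclideanSpace_fin,
    abs_of_nonneg (by positivity), measureReal_def]

/-- Layer-cake formula: the sublevel set of `J` at height `s` is a homothetic copy of `Ω` of volume
`s^D |Ω|`, which reduces the integral to `|Ω| ∫₀¹ (1 - t^(D/q)) dt`. -/
theorem IsGaugeAt.integral_rpow {x₀ : E D} {J : E D → ℝ} (h : IsGaugeAt Ω x₀ J)
    (ho : IsOpen Ω) (hb : Bornology.IsBounded Ω) (hJ : Continuous J) {q : ℝ} (hq : 0 < q) :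
    ∫ x in Ω, J x ^ q = volume.real Ω * (D / (D + q)) := by
  have hfin : volume Ω ≠ ⊤ := hb.measure_lt_top.ne
  have hfin' : IsFiniteMeasure (volume.restrict Ω) := ⟨by simpa using hfin.lt_top⟩
  have hc : Continuous fun x => J x ^ q := hJ.rpow_const fun x => Or.inr hq.le
  have h1 : ∀ᵐ x ∂(volume.restrict Ω), J x ^ q ≤ 1 := by
    filter_upwards [ae_restrict_mem ho.measurableSet] with x hx
    exact Real.rpow_le_one (h.nonneg x) ((h.lt_one_iff x).2 hx).le hq.le
  have hi : Integrable (fun x => J x ^ q) (volume.restrict Ω) := by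
    refine Integrable.mono' (integrable_const 1) hc.aestronglyMeasurable ?_
    filter_upwards [h1] with x hx
    rwa [Real.norm_of_nonneg (Real.rpow_nonneg (h.nonneg x) q)]
  rw [hi.integral_eq_integral_Ioc_meas_le
    (Eventually.of_forall fun x => Real.rpow_nonneg (h.nonneg x) q) h1]
  have h2 : ∀ t ∈ Set.Ioc (0 : ℝ) 1, (volume.restrict Ω).real {x | t ≤ J x ^ q} =
      volume.real Ω * (1 - t ^ (D / q)) := by
    intro t ht
    have hs : 0 < t ^ q⁻¹ := Real.rpow_pos_of_pos ht.1 _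
    have hset : {x | t ≤ J x ^ q} ∩ Ω = Ω \ {x | J x < t ^ q⁻¹} := by
      ext x
      simp only [Set.mem_inter_iff, Set.mem_ofPred_eq, Set.mem_sdiff, not_lt]
      rw [Real.rpow_inv_le_iff_of_pos ht.1.le (h.nonneg x) hq, and_comm]
    have hsub : {x | J x < t ^ q⁻¹} ⊆ Ω := fun x hx => (h.lt_one_iff x).1
      (lt_of_lt_of_le hx (Real.rpow_le_one ht.1.le ht.2 (by positivity)))
    have hmeas : MeasurableSet {x | J x < t ^ q⁻¹} := (isOpen_lt hJ continuous_const).measurableSet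
    rw [measureReal_restrict_apply' ho.measurableSet, hset,
      measureReal_sdiff hsub hmeas hfin, h.volume_lt hs,
      ← Real.rpow_natCast, ← Real.rpow_mul ht.1.le, inv_mul_eq_div]
    ring
  rw [setIntegral_congr_fun measurableSet_Ioc h2, integral_const_mul]
  have hDq : 0 ≤ (D : ℝ) / q := by positivity
  have h3 : ∫ t in Set.Ioc (0 : ℝ) 1, (1 - t ^ ((D : ℝ) / q)) = 1 - 1 / (D / q + 1) := by
    rw [← intervalIntegral.integral_of_le zero_le_one, intervalIntegral.integral_sub
      intervalIntegrable_const (intervalIntegral.intervalIntegrable_rpow' (by linarith)),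
      _root_.integral_rpow (Or.inl (by linarith))]
    rw [Real.one_rpow, Real.zero_rpow (by linarith)]
    simp
  rw [h3]
  congr 1
  field_simp
  ring

/-- The Minkowski functional of `Ω` translated to the origin; the inscribed ball of radius `r`
forces slope at most `1 / r`. -/
theorem exists_gauge (ho : IsOpen Ω) (hcv : Convex ℝ Ω) {x₀ : E D} {r : ℝ} (hr : 0 < r)
    (hball : Metric.ball x₀ r ⊆ Ω) :
    ∃ J : E D → ℝ, IsGaugeAt Ω x₀ J ∧ LipschitzWith (Real.toNNReal r)⁻¹ J := by
  set K : Set (E D) := (fun v => x₀ + v) ⁻¹' Ω with hK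
  have hKo : IsOpen K := ho.preimage (by fun_prop)
  have hKc : Convex ℝ K := hcv.translate_preimage_right x₀
  have hKb : Metric.ball (0 : E D) (Real.toNNReal r) ⊆ K := by
    intro v hv
    rw [Real.coe_toNNReal r hr.le, mem_ball_zero_iff] at hv
    exact hball (by simpa [Metric.mem_ball, dist_eq_norm] using hv)
  have h0 : (0 : E D) ∈ K := hKb (Metric.mem_ball_self (by simpa using hr))
  have hg1 : ∀ v, gauge K v < 1 ↔ v ∈ K := fun v => by
    have := setOfPred_gauge_lt_one_eq_self_of_isOpen hKc h0 hKo
    exact Set.ext_iff.1 this v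
  refine ⟨fun x => gauge K (x - x₀), ⟨fun x => gauge_nonneg _, fun x => ?_, fun t ht v => ?_⟩, ?_⟩
  · rw [hg1, hK, Set.mem_preimage, add_sub_cancel]
  · rw [add_sub_cancel_left, add_sub_cancel_left, gauge_smul_of_nonneg ht.le, smul_eq_mul]
  · refine LipschitzWith.of_dist_le_mul fun x y => ?_
    have := (hKc.lipschitzWith_gauge (by simpa using hr) hKb).dist_le_mul (x - x₀) (y - x₀)
    rwa [dist_sub_right] at this

theorem abs_rpow_sub_le {q : ℝ} (hq : 1 ≤ q) {a b : ℝ} (ha : a ∈ Set.Icc (0 : ℝ) 1)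
    (hb : b ∈ Set.Icc (0 : ℝ) 1) : |b ^ q - a ^ q| ≤ q * |b - a| := by
  refine Convex.norm_image_sub_le_of_norm_hasDerivWithin_le (f := fun x : ℝ => x ^ q)
    (f' := fun x => q * x ^ (q - 1)) (s := Set.Icc 0 1)
    (fun x _ => (Real.hasDerivAt_rpow_const (Or.inr hq)).hasDerivWithinAt) (fun x hx => ?_)
    (convex_Icc 0 1) ha hb
  rw [Real.norm_of_nonneg (mul_nonneg (by linarith) (Real.rpow_nonneg hx.1 _))]
  exact mul_le_of_le_one_right (by linarith) (Real.rpow_le_one hx.1 hx.2 (by linarith))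

/-- The truncated profile `1 - J ^ q`. -/
def profile (q : ℝ) (J : E D → ℝ) (x : E D) : ℝ := 1 - min (J x) 1 ^ q

theorem lipschitzWith_profile {q : ℝ} (hq : 1 ≤ q) {J : E D → ℝ} {C : NNReal}
    (hJ : LipschitzWith C J) (h0 : ∀ x, 0 ≤ J x) : LipschitzWith (q.toNNReal * C) (profile q J) := by
  refine LipschitzWith.of_dist_le_mul fun x y => ?_
  have hm : ∀ z, min (J z) 1 ∈ Set.Icc (0 : ℝ) 1 := fun z =>
    ⟨le_min (h0 z) zero_le_one, min_le_right _ _⟩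
  have h1 := abs_rpow_sub_le hq (hm x) (hm y)
  have h2 := (hJ.min_const 1).dist_le_mul y x
  rw [Real.dist_eq] at h2 ⊢
  unfold profile
  rw [sub_sub_sub_cancel_left, NNReal.coe_mul, Real.coe_toNNReal q (by linarith), mul_assoc,
    dist_comm x y]
  exact h1.trans (by gcongr)

theorem IsGaugeAt.fderiv_profile {x₀ : E D} {J : E D → ℝ} (h : IsGaugeAt Ω x₀ J)
    (ho : IsOpen Ω) {q : ℝ} (hq : 1 ≤ q) {x : E D} (hx : x ∈ Ω) (hd : DifferentiableAt ℝ J x) :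
    ‖fderiv ℝ (profile q J) x‖ = q * J x ^ (q - 1) * ‖fderiv ℝ J x‖ := by
  have h1 : profile q J =ᶠ[𝓝 x] fun y => 1 - J y ^ q := by
    filter_upwards [ho.mem_nhds hx] with y hy
    rw [profile, min_eq_left ((h.lt_one_iff y).2 hy).le]
  have h2 := (hd.hasFDerivAt.rpow_const (p := q) (Or.inr hq)).const_sub 1
  rw [h1.fderiv_eq, h2.fderiv, norm_neg, norm_smul, Real.norm_of_nonneg
    (mul_nonneg (by linarith) (Real.rpow_nonneg (h.nonneg x) _))]

theorem IsGaugeAt.profile_eq_zero {x₀ : E D} {J : E D → ℝ} (h : IsGaugeAt Ω x₀ J) (q : ℝ)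
    {x : E D} (hx : x ∉ Ω) : profile q J x = 0 := by
  have : 1 ≤ J x := not_lt.1 fun h' => hx ((h.lt_one_iff x).1 h')
  rw [profile, min_eq_right this, Real.one_rpow, sub_self]

/-- Points outside `Ω`, boundary points included, are minima of the nonnegative profile, so there is
no need to know that the boundary is a null set. -/
theorem IsGaugeAt.fderiv_profile_eq_zero {x₀ : E D} {J : E D → ℝ} (h : IsGaugeAt Ω x₀ J)
    {q : ℝ} (hq : 1 ≤ q) {x : E D} (hx : x ∉ Ω) : fderiv ℝ (profile q J) x = 0 := by
  refine IsLocalMin.fderiv_eq_zero (Eventually.of_forall fun y => ?_)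
  rw [h.profile_eq_zero q hx, profile, sub_nonneg]
  exact Real.rpow_le_one (le_min (h.nonneg y) zero_le_one) (min_le_right _ _) (by linarith)

theorem IsGaugeAt.integrableOn_rpow_mul {x₀ : E D} {J : E D → ℝ} (h : IsGaugeAt Ω x₀ J)
    (ho : IsOpen Ω) (hb : Bornology.IsBounded Ω) {C : NNReal} (hJ : LipschitzWith C J) {q : ℝ}
    (hq : 0 ≤ q) (hp : 0 ≤ p) :
    Integrable (fun x => J x ^ q * ‖fderiv ℝ J x‖ ^ p) (volume.restrict Ω) := by
  have hfin : IsFiniteMeasure (volume.restrict Ω) := ⟨by simpa using hb.measure_lt_top⟩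
  have hc : Continuous fun x => J x ^ q := hJ.continuous.rpow_const fun x => Or.inr hq
  refine Integrable.mono' (integrable_const ((C : ℝ) ^ p))
    (hc.aestronglyMeasurable.mul ((measurable_fderiv ℝ J).norm.pow_const p).aestronglyMeasurable) ?_
  filter_upwards [ae_restrict_mem ho.measurableSet] with x hx
  have h1 := Real.rpow_nonneg (h.nonneg x) q
  have h2 := Real.rpow_le_one (h.nonneg x) ((h.lt_one_iff x).2 hx).le hq
  rw [Real.norm_of_nonneg (by positivity)]
  calc _ ≤ 1 * (C : ℝ) ^ p := by
        gcongr
        exact norm_fderiv_le_of_lipschitz ℝ hJ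
    _ = _ := one_mul _

/-- A lower bound for the torsional rigidity from the profile `1 - J ^ q`. -/
theorem IsGaugeAt.volume_le (hD : 0 < D) (hp : 1 < p) (ho : IsOpen Ω)
    (hb : Bornology.IsBounded Ω) {x₀ : E D} {J : E D → ℝ} (h : IsGaugeAt Ω x₀ J) {C : NNReal}
    (hJ : LipschitzWith C J) {q : ℝ} (hpq : p.HolderConjugate q) :
    volume.real Ω * (q / (D + q)) ≤ torsionalRigidity p Ω ^ (1 - 1 / p) *
      (q * (∫ x in Ω, J x ^ q * ‖fderiv ℝ J x‖ ^ p) ^ (1 / p)) := by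
  have hp0 : 0 < p := by linarith
  have hq1 := hpq.symm.lt
  have hq0 : 0 < q := by linarith
  have hD' : (0 : ℝ) < D := by exact_mod_cast hD
  have hfin : volume Ω ≠ ⊤ := hb.measure_lt_top.ne
  have hfin' : IsFiniteMeasure (volume.restrict Ω) := ⟨by simpa using hfin.lt_top⟩
  have key := integral_le_of_lipschitz hD hp ho hb
    (lipschitzWith_profile hq1.le hJ h.nonneg) (fun x hx => h.profile_eq_zero q hx)
  have h1 : ∫ x, profile q J x = volume.real Ω * (q / (D + q)) := by
    rw [← setIntegral_eq_integral_of_forall_compl_eq_zero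
      (fun x hx => h.profile_eq_zero q hx : ∀ x, x ∉ Ω → profile q J x = 0)]
    have h2 : ∀ x ∈ Ω, profile q J x = 1 - J x ^ q := fun x hx => by
      rw [profile, min_eq_left ((h.lt_one_iff x).2 hx).le]
    rw [setIntegral_congr_fun ho.measurableSet h2, integral_sub (integrable_const 1),
      h.integral_rpow ho hb hJ.continuous hq0]
    · simp
      field_simp
      ring
    · have := h.integrableOn_rpow_mul ho hb hJ hq0.le le_rfl
      simpa using this
  -- The exponent `q` is chosen so that `(q - 1) p = q`: the gradient term carries the same power of
  -- `J` as the profile.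
  have h3 : ∫ x, ‖fderiv ℝ (profile q J) x‖ ^ p =
      q ^ p * ∫ x in Ω, J x ^ q * ‖fderiv ℝ J x‖ ^ p := by
    rw [← setIntegral_eq_integral_of_forall_compl_eq_zero (s := Ω)
      (fun x hx => by rw [h.fderiv_profile_eq_zero hq1.le hx, norm_zero, Real.zero_rpow hp0.ne']),
      ← integral_const_mul]
    refine integral_congr_ae ?_
    filter_upwards [ae_restrict_mem ho.measurableSet,
      ae_restrict_of_ae (hJ.ae_differentiableAt (μ := volume))] with x hx hd
    have h4 := h.nonneg x
    rw [h.fderiv_profile ho hq1.le hx hd, Real.mul_rpow (by positivity) (norm_nonneg _),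
      Real.mul_rpow hq0.le (by positivity), ← Real.rpow_mul h4, hpq.symm.sub_one_mul_conj, mul_assoc]
  have h5 : 0 ≤ ∫ x in Ω, J x ^ q * ‖fderiv ℝ J x‖ ^ p := integral_nonneg fun x =>
    mul_nonneg (Real.rpow_nonneg (h.nonneg x) _) (by positivity)
  rwa [h1, h3, Real.mul_rpow (by positivity) h5, ← Real.rpow_mul hq0.le,
    mul_one_div_cancel hp0.ne', Real.rpow_one] at key

/-! ### The inradius -/

theorem compl_nonempty (hD : 0 < D) (hb : Bornology.IsBounded Ω) : (Ωᶜ).Nonempty := by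
  have : Nonempty (Fin D) := ⟨⟨0, hD⟩⟩
  have : Nontrivial (E D) := inferInstance
  have : NoncompactSpace (E D) := NormedSpace.noncompactSpace ℝ (E D)
  by_contra hne
  rw [Set.not_nonempty_iff_eq_empty, Set.compl_empty_iff] at hne
  rw [hne] at hb
  exact noncompact_univ (E D) (Metric.isCompact_of_isClosed_isBounded isClosed_univ hb)

theorem le_infDist_of_ball_subset (hne : (Ωᶜ).Nonempty) {x : E D} {r : ℝ}
    (h : Metric.ball x r ⊆ Ω) : r ≤ Metric.infDist x Ωᶜ := by
  rw [Metric.le_infDist hne]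
  intro y hy
  by_contra! hlt
  exact hy (h (Metric.mem_ball'.2 hlt))

/-- The inradius is attained. -/
theorem exists_incenter (hD : 0 < D) (hΩ : Ω ∈ convexDomains D) :
    0 < inradius Ω ∧ (∀ x, Metric.infDist x Ωᶜ ≤ inradius Ω) ∧
      ∃ x₀, Metric.ball x₀ (inradius Ω) ⊆ Ω := by
  obtain ⟨⟨z, hz⟩, ho, hb, hcv⟩ := hΩ
  have hne := compl_nonempty hD hb
  have hc : Continuous fun x : E D => Metric.infDist x Ωᶜ := Metric.continuous_infDist_pt _
  obtain ⟨x₀, -, hmax⟩ := hb.isCompact_closure.exists_isMaxOn ⟨z, subset_closure hz⟩ hc.continuousOn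
  have hmax' : ∀ x, Metric.infDist x Ωᶜ ≤ Metric.infDist x₀ Ωᶜ := by
    intro x
    by_cases hx : x ∈ Ω
    · exact hmax (subset_closure hx)
    · rw [Metric.infDist_zero_of_mem (by simpa using hx)]
      exact Metric.infDist_nonneg
  have hgr : IsGreatest {r : ℝ | 0 ≤ r ∧ ∃ x : E D, Metric.ball x r ⊆ Ω}
      (Metric.infDist x₀ Ωᶜ) :=
    ⟨⟨Metric.infDist_nonneg, x₀, Metric.ball_infDist_compl_subset⟩, fun r ⟨_, x, hx⟩ =>
      (le_infDist_of_ball_subset hne hx).trans (hmax' x)⟩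
  have hR : inradius Ω = Metric.infDist x₀ Ωᶜ := hgr.csSup_eq
  rw [hR]
  refine ⟨?_, hmax', x₀, Metric.ball_infDist_compl_subset⟩
  obtain ⟨ε, hε, hball⟩ := Metric.isOpen_iff.1 ho z hz
  exact hε.trans_le ((le_infDist_of_ball_subset hne hball).trans (hmax' z))

/-- For `J x < s < 1` the point `x₀ + s⁻¹ (x - x₀)` lies in `Ω`. Convex combinations of it with the
ball of radius `R` about `x₀`, with weights `s` and `1 - s`, fill the ball of radius `(1 - s) R`
about `x`. Let `s` decrease to `J x`. -/
theorem IsGaugeAt.one_sub_mul_le_infDist (hcv : Convex ℝ Ω) (hne : (Ωᶜ).Nonempty) {x₀ : E D}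
    {J : E D → ℝ} (h : IsGaugeAt Ω x₀ J) {R : ℝ} (hball : Metric.ball x₀ R ⊆ Ω)
    {x : E D} (hx : x ∈ Ω) : R - Metric.infDist x Ωᶜ ≤ R * J x := by
  have hJ1 := (h.lt_one_iff x).2 hx
  have key : ∀ s, J x < s → s < 1 → (1 - s) * R ≤ Metric.infDist x Ωᶜ := by
    intro s hs hs1
    have hs0 : 0 < s := (h.nonneg x).trans_lt hs
    have hs1' : 0 < 1 - s := by linarith
    refine le_infDist_of_ball_subset hne fun y hy => ?_
    have hw : x₀ + s⁻¹ • (x - x₀) ∈ Ω := by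
      rw [← h.lt_one_iff, h.map_smul _ (inv_pos.2 hs0), add_sub_cancel, inv_mul_lt_iff₀ hs0,
        mul_one]
      exact hs
    have hz : x₀ + (1 - s)⁻¹ • (y - x) ∈ Ω := by
      refine hball ?_
      rw [Metric.mem_ball, dist_eq_norm, add_sub_cancel_left, norm_smul, norm_inv,
        Real.norm_of_nonneg hs1'.le, inv_mul_lt_iff₀ hs1', ← dist_eq_norm]
      exact hy
    have := hcv hw hz hs0.le hs1'.le (by ring)
    convert this using 1
    rw [smul_add, smul_add, smul_smul, smul_smul, mul_inv_cancel₀ hs0.ne',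
      mul_inv_cancel₀ hs1'.ne', sub_smul]
    simp only [one_smul]
    abel
  have hlim : Tendsto (fun s : ℝ => (1 - s) * R) (𝓝[>] (J x)) (𝓝 ((1 - J x) * R)) :=
    (((continuous_const.sub continuous_id).mul continuous_const).tendsto (J x)).mono_left
      nhdsWithin_le_nhds
  have h1 := le_of_tendsto hlim (by
    filter_upwards [Ioo_mem_nhdsGT hJ1] with s hs using key s hs.1 hs.2)
  linarith

/-! ### The upper bound for the torsional rigidity -/

theorem norm_fderiv_abs_le {f : E D → ℝ} {x : E D} (hx : DifferentiableAt ℝ f x) :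
    ‖fderiv ℝ (fun y => |f y|) x‖ ≤ ‖fderiv ℝ f x‖ := by
  rcases lt_trichotomy (f x) 0 with h | h | h
  · have : (fun y => |f y|) =ᶠ[𝓝 x] fun y => -f y := by
      filter_upwards [hx.continuousAt.eventually_lt_const h] with y hy
      exact abs_of_neg hy
    rw [this.fderiv_eq, fderiv_fun_neg, norm_neg]
  · have : IsLocalMin (fun y => |f y|) x := Eventually.of_forall fun y => by
      simp [h]
    rw [this.fderiv_eq_zero]
    simp
  · have : (fun y => |f y|) =ᶠ[𝓝 x] f := by
      filter_upwards [hx.continuousAt.eventually_const_lt h] with y hy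
      exact abs_of_pos hy
    rw [this.fderiv_eq]

/-- Hölder's inequality against a bounded weight. -/
theorem integral_norm_gradient_mul_le {q : ℝ} (hpq : p.HolderConjugate q) (ho : IsOpen Ω)
    (hb : Bornology.IsBounded Ω) {φ : E D → ℝ} (hφ : IsTestFunction Ω φ) {w : E D → ℝ}
    (hw : Continuous w) (hw0 : ∀ x, 0 ≤ w x) :
    ∫ x, ‖gradient φ x‖ * w x ≤
      (∫ x in Ω, w x ^ q) ^ (1 / q) * (∫ x, ‖gradient φ x‖ ^ p) ^ (1 / p) := by
  have hfin : IsFiniteMeasure (volume.restrict Ω) := ⟨by simpa using hb.measure_lt_top⟩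
  have hwL : MemLp w (ENNReal.ofReal q) (volume.restrict Ω) := by
    obtain ⟨B, hB⟩ := hb.isCompact_closure.exists_bound_of_continuousOn hw.continuousOn
    refine MemLp.of_bound hw.aestronglyMeasurable B ?_
    filter_upwards [ae_restrict_mem ho.measurableSet] with x hx using hB x (subset_closure hx)
  have := integral_mul_le_Lp_mul_Lq_of_nonneg (μ := volume.restrict Ω) hpq.symm
    (Eventually.of_forall hw0) (Eventually.of_forall fun x => norm_nonneg (gradient φ x)) hwL
    ((hφ.memLp_gradient _).restrict Ω).norm
  rw [hφ.setIntegral_norm_gradient_rpow hpq.lt] at this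
  refine le_trans (le_of_eq ?_) this
  rw [← setIntegral_eq_integral_of_forall_compl_eq_zero (s := Ω)
    (fun x hx => by rw [hφ.gradient_eq_zero hx, norm_zero, zero_mul])]
  simp only [mul_comm]

/-- The Hardy-type inequality is applied to `|φ|`, since it needs a nonnegative function. Hölder's
inequality separates the weight `R - d`, which is dominated by `R J` with `J` the gauge about an
incentre. -/
theorem torsionalRigidity_rpow_le_inradius (hD : 0 < D) {q : ℝ} (hpq : p.HolderConjugate q)
    (hΩ : Ω ∈ convexDomains D) :
    torsionalRigidity p Ω ^ (1 - 1 / p) ≤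
      inradius Ω * (volume.real Ω * (D / (D + q))) ^ (1 / q) := by
  obtain ⟨hR0, hR, x₀, hball⟩ := exists_incenter hD hΩ
  obtain ⟨-, ho, hb, hcv⟩ := hΩ
  have hne := compl_nonempty hD hb
  have hq0 : 0 < q := hpq.symm.pos
  set R := inradius Ω
  obtain ⟨J, hJ, hJL⟩ := exists_gauge ho hcv hR0 hball
  have hw : Continuous fun x : E D => R - Metric.infDist x Ωᶜ :=
    continuous_const.sub (Metric.continuous_infDist_pt _)
  have hw0 : ∀ x, 0 ≤ R - Metric.infDist x Ωᶜ := fun x => sub_nonneg.2 (hR x)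
  have hfin : IsFiniteMeasure (volume.restrict Ω) := ⟨by simpa using hb.measure_lt_top⟩
  refine torsionalRigidity_rpow_le hD hpq.lt hb (by positivity) fun φ hφ => ?_
  obtain ⟨C, hC⟩ := ContDiff.lipschitzWith_of_hasCompactSupport hφ.2.1 hφ.1 (by simp)
  have habs : LipschitzWith C fun x => |φ x| := by
    refine LipschitzWith.of_dist_le_mul fun x y => ?_
    refine le_trans ?_ (hC.dist_le_mul x y)
    rw [Real.dist_eq, Real.dist_eq]
    exact abs_abs_sub_abs_le _ _
  have habss : tsupport (fun x => |φ x|) ⊆ tsupport φ := closure_mono fun x hx => by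
    simpa using hx
  have hgi : Integrable fun x => ‖gradient φ x‖ * (R - Metric.infDist x Ωᶜ) :=
    (hφ.continuous_gradient.norm.mul hw).integrable_of_hasCompactSupport
      (hasCompactSupport_gradient hφ.2.1).norm.mul_right
  have habsc : HasCompactSupport fun x => |φ x| := hφ.2.1.norm
  calc ∫ x, φ x ≤ ∫ x, |φ x| :=
        integral_mono hφ.integrable hφ.integrable.abs fun x => le_abs_self _
    _ ≤ ∫ x, ‖fderiv ℝ (fun y => |φ y|) x‖ * (R - Metric.infDist x Ωᶜ) :=
        integral_le_integral_fderiv_mul ho hcv hne hR habs habsc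
          (habss.trans hφ.2.2) fun x => abs_nonneg _
    _ ≤ ∫ x, ‖gradient φ x‖ * (R - Metric.infDist x Ωᶜ) := by
        refine integral_mono_of_nonneg (Eventually.of_forall fun x =>
          mul_nonneg (norm_nonneg _) (hw0 x)) hgi (Eventually.of_forall fun x => ?_)
        simp only
        rw [norm_gradient]
        exact mul_le_mul_of_nonneg_right (norm_fderiv_abs_le (hφ.differentiable x)) (hw0 x)
    _ ≤ (∫ x in Ω, (R - Metric.infDist x Ωᶜ) ^ q) ^ (1 / q) *
        (∫ x, ‖gradient φ x‖ ^ p) ^ (1 / p) :=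
        integral_norm_gradient_mul_le hpq ho hb hφ hw hw0
    _ ≤ _ := by
        have h1 : ∫ x in Ω, (R - Metric.infDist x Ωᶜ) ^ q ≤ ∫ x in Ω, R ^ q * J x ^ q := by
          refine integral_mono_of_nonneg (Eventually.of_forall fun x =>
            Real.rpow_nonneg (hw0 x) q) ?_ ?_
          · have := (hJ.integrableOn_rpow_mul ho hb hJL hq0.le le_rfl).const_mul (R ^ q)
            simpa using this
          · filter_upwards [ae_restrict_mem ho.measurableSet] with x hx
            rw [← Real.mul_rpow hR0.le (hJ.nonneg x)]
            exact Real.rpow_le_rpow (hw0 x)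
              (hJ.one_sub_mul_le_infDist hcv hne hball hx) hq0.le
        rw [integral_const_mul, hJ.integral_rpow ho hb hJL.continuous hq0] at h1
        have h2 := Real.rpow_le_rpow (integral_nonneg fun x => Real.rpow_nonneg (hw0 x) q) h1
          (by positivity : 0 ≤ 1 / q)
        rw [Real.mul_rpow (by positivity) (by positivity), ← Real.rpow_mul hR0.le,
          mul_one_div_cancel hq0.ne', Real.rpow_one] at h2
        exact mul_le_mul_of_nonneg_right h2
          (Real.rpow_nonneg (integral_nonneg fun x => by positivity) _)

end

section

open scoped Pointwise

variable {D : ℕ} {Ω : Set (E D)} {p : ℝ}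

/-! ### A scale-invariant ratio -/

/-- A multiple of `Q p Ω` normalized to take values in `[1, D]`. -/
def torsionRatio (p q : ℝ) (Ω : Set (E D)) : ℝ :=
  inradius Ω * (volume.real Ω * (D / (D + q))) ^ (1 / q) / torsionalRigidity p Ω ^ (1 - 1 / p)

theorem volume_pos (hΩ : Ω ∈ convexDomains D) : 0 < volume.real Ω :=
  ENNReal.toReal_pos (hΩ.2.1.measure_pos volume hΩ.1).ne' hΩ.2.2.1.measure_lt_top.ne

/-- With `W = V D / (D + q)` the left side of `h` is `q W / D`; splitting `W = W^(1/q) W^(1/p)` lets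
`W^(1/p)` cancel. -/
theorem rpow_div_le_of_volume_le (hD : 0 < D) {q : ℝ} (hpq : p.HolderConjugate q) {V τ A : ℝ}
    (hV : 0 < V) (hτ : 0 ≤ τ) (hA : 0 ≤ A) {r : ℝ} (hr : 0 < r)
    (h : V * (q / (D + q)) ≤ τ * (q * A ^ (1 / p)))
    (hAV : A ≤ r⁻¹ ^ p * (V * (D / (D + q)))) :
    r * (V * (D / (D + q))) ^ (1 / q) / D ≤ τ := by
  have hp0 := hpq.pos
  have hq0 := hpq.symm.pos
  have hD' : (0 : ℝ) < D := by exact_mod_cast hD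
  have h1 : V * (q / (D + q)) = q * ((V * (D / (D + q))) / D) := by field_simp
  set W := V * (D / (D + q)) with hW
  have hW0 : 0 < W := by positivity
  have h2 : A ^ (1 / p) ≤ r⁻¹ * W ^ (1 / p) := by
    have := Real.rpow_le_rpow hA hAV (by positivity : 0 ≤ 1 / p)
    rwa [Real.mul_rpow (by positivity) hW0.le, ← Real.rpow_mul (by positivity),
      mul_one_div_cancel hp0.ne', Real.rpow_one] at this
  have h3 : q * (W / D) ≤ τ * (q * (r⁻¹ * W ^ (1 / p))) := by
    rw [← h1]
    exact h.trans (by gcongr)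
  have h4 : W / D ≤ τ * (r⁻¹ * W ^ (1 / p)) := by
    refine le_of_mul_le_mul_left ?_ hq0
    linarith
  have h5 : W = W ^ (1 / q) * W ^ (1 / p) := by
    have := hpq.inv_add_inv_eq_one
    rw [← Real.rpow_add hW0, one_div, one_div, add_comm, this, Real.rpow_one]
  have h6 : 0 < W ^ (1 / p) := by positivity
  refine le_of_mul_le_mul_right ?_ h6
  calc r * W ^ (1 / q) / D * W ^ (1 / p) = r * (W / D) := by
        conv_rhs => rw [h5]
        ring
    _ ≤ r * (τ * (r⁻¹ * W ^ (1 / p))) := by gcongr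
    _ = τ * W ^ (1 / p) := by field_simp

theorem IsGaugeAt.integral_fderiv_le (ho : IsOpen Ω) (hb : Bornology.IsBounded Ω) {x₀ : E D}
    {J : E D → ℝ} (h : IsGaugeAt Ω x₀ J) {C : NNReal} (hJ : LipschitzWith C J) {q : ℝ}
    (hq : 0 < q) (hp : 0 ≤ p) :
    ∫ x in Ω, J x ^ q * ‖fderiv ℝ J x‖ ^ p ≤ C ^ p * (volume.real Ω * (D / (D + q))) := by
  rw [← h.integral_rpow ho hb hJ.continuous hq, ← integral_const_mul]
  refine integral_mono (h.integrableOn_rpow_mul ho hb hJ hq.le hp) ?_ fun x => ?_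
  · have := (h.integrableOn_rpow_mul ho hb hJ hq.le le_rfl).const_mul ((C : ℝ) ^ p)
    simpa using this
  · simp only
    rw [mul_comm]
    have h1 := Real.rpow_nonneg (h.nonneg x) q
    gcongr
    exact norm_fderiv_le_of_lipschitz ℝ hJ

theorem IsGaugeAt.integral_fderiv_nonneg {x₀ : E D}
    {J : E D → ℝ} (h : IsGaugeAt Ω x₀ J) (q p : ℝ) :
    0 ≤ ∫ x in Ω, J x ^ q * ‖fderiv ℝ J x‖ ^ p :=
  integral_nonneg fun x => mul_nonneg (Real.rpow_nonneg (h.nonneg x) _) (by positivity)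

/-- The competitor is `1 - J^q`, with `J` the gauge about an incentre and hence of slope at most `1
/ R`. The result misses the upper bound by exactly the factor `D`. -/
theorem inradius_mul_le_torsionalRigidity_rpow (hD : 0 < D) {q : ℝ} (hpq : p.HolderConjugate q)
    (hΩ : Ω ∈ convexDomains D) :
    inradius Ω * (volume.real Ω * (D / (D + q))) ^ (1 / q) / D ≤
      torsionalRigidity p Ω ^ (1 - 1 / p) := by
  obtain ⟨hR0, hR, x₀, hball⟩ := exists_incenter hD hΩ
  have hV := volume_pos hΩ
  obtain ⟨-, ho, hb, hcv⟩ := hΩ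
  obtain ⟨J, hJ, hJL⟩ := exists_gauge ho hcv hR0 hball
  have h1 := hJ.volume_le hD hpq.lt ho hb hJL hpq
  refine rpow_div_le_of_volume_le hD hpq hV
    (Real.rpow_nonneg (torsionalRigidity_nonneg hD hpq.lt hb) _)
    (hJ.integral_fderiv_nonneg q p) hR0 h1 ?_
  have := hJ.integral_fderiv_le ho hb hJL hpq.symm.pos hpq.nonneg
  rwa [NNReal.coe_inv, Real.coe_toNNReal _ hR0.le] at this

theorem torsionalRigidity_rpow_pos (hD : 0 < D) (hp : 1 < p) (hΩ : Ω ∈ convexDomains D) :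
    0 < torsionalRigidity p Ω ^ (1 - 1 / p) := by
  have hpq := Real.HolderConjugate.conjExponent hp
  have hq0 := hpq.symm.pos
  have hD' : (0 : ℝ) < D := by exact_mod_cast hD
  have hV := volume_pos hΩ
  have hR := (exists_incenter hD hΩ).1
  refine lt_of_lt_of_le ?_ (inradius_mul_le_torsionalRigidity_rpow hD hpq hΩ)
  positivity

theorem torsionRatio_mem_Icc (hD : 0 < D) {q : ℝ} (hpq : p.HolderConjugate q)
    (hΩ : Ω ∈ convexDomains D) : torsionRatio p q Ω ∈ Set.Icc (1 : ℝ) D := by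
  have hD' : (0 : ℝ) < D := by exact_mod_cast hD
  have hτ := torsionalRigidity_rpow_pos hD hpq.lt hΩ
  constructor
  · rw [torsionRatio, le_div_iff₀ hτ, one_mul]
    exact torsionalRigidity_rpow_le_inradius hD hpq hΩ
  · rw [torsionRatio, div_le_iff₀ hτ, mul_comm (D : ℝ), ← div_le_iff₀ hD']
    exact inradius_mul_le_torsionalRigidity_rpow hD hpq hΩ

/-! ### The ball and a truncated ball -/

/-- A ball inside the slab `|x i| < 1` has radius at most `1`, as its points `x₀ ± s e_i` show. -/
theorem inradius_eq_one {i : Fin D} (hΩ : Ω ∈ convexDomains D)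
    (hball : Metric.ball 0 1 ⊆ Ω) (hi : ∀ x ∈ Ω, |x i| < 1) : inradius Ω = 1 := by
  have hD : 0 < D := i.pos
  obtain ⟨hR0, hR, x₀, hx₀⟩ := exists_incenter hD hΩ
  refine le_antisymm ?_ ((le_infDist_of_ball_subset (compl_nonempty hD hΩ.2.2.1) hball).trans (hR 0))
  refine le_of_forall_lt fun s hs => ?_
  by_cases hs0 : s < 0
  · linarith
  · have hs0' : 0 ≤ s := not_lt.1 hs0
    have hmem : ∀ c : ℝ, |c| = s → |x₀ i + c| < 1 := by
      intro c hc
      have := hi (x₀ + EuclideanSpace.single i c) (hx₀ (by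
        rw [Metric.mem_ball, dist_eq_norm, add_sub_cancel_left]
        simpa [hc] using hs))
      simpa using this
    have h1 := abs_lt.1 (hmem s (abs_of_nonneg hs0'))
    have h2 := abs_lt.1 (hmem (-s) (by rw [abs_neg, abs_of_nonneg hs0']))
    linarith

theorem abs_apply_le_norm (x : E D) (i : Fin D) : |x i| ≤ ‖x‖ := by
  simpa using PiLp.norm_apply_le x i

theorem ball_mem_convexDomains : Metric.ball (0 : E D) 1 ∈ convexDomains D :=
  ⟨⟨0, Metric.mem_ball_self one_pos⟩, Metric.isOpen_ball, Metric.isBounded_ball, convex_ball _ _⟩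

theorem isGaugeAt_norm : IsGaugeAt (Metric.ball (0 : E D) 1) 0 fun x => ‖x‖ where
  nonneg _ := norm_nonneg _
  lt_one_iff x := by simp
  map_smul t ht v := by simp [norm_smul, abs_of_pos ht]

/-- The unit ball maximizes `torsionRatio`. -/
theorem le_torsionRatio_ball (hD : 0 < D) {q : ℝ} (hpq : p.HolderConjugate q) :
    D ≤ torsionRatio p q (Metric.ball (0 : E D) 1) := by
  have hD' : (0 : ℝ) < D := by exact_mod_cast hD
  have hq0 := hpq.symm.pos
  set B := Metric.ball (0 : E D) 1
  have hB : B ∈ convexDomains D := ball_mem_convexDomains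
  have hR : inradius B = 1 := inradius_eq_one (i := ⟨0, hD⟩) hB subset_rfl fun x hx =>
    (abs_apply_le_norm x _).trans_lt (by simpa [B] using hx)
  rw [torsionRatio, hR, one_mul, le_div_iff₀ (torsionalRigidity_rpow_pos hD hpq.lt hB),
    ← le_div_iff₀' hD']
  refine torsionalRigidity_rpow_le hD hpq.lt hB.2.2.1 (by positivity) fun φ hφ => ?_
  -- On the ball the divergence theorem for `φ x` gives `D ∫ φ ≤ ∫ |∇φ| |x|`, better by the factor
  -- `D` than the Hardy-type inequality.
  have h1 := integral_fderiv_self hφ.contDiff_one hφ.2.1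
  have h2 := integral_norm_gradient_mul_le hpq hB.2.1 hB.2.2.1 hφ continuous_norm
    fun x => norm_nonneg x
  rw [isGaugeAt_norm.integral_rpow hB.2.1 hB.2.2.1 continuous_norm hq0] at h2
  have h3 : -∫ x, fderiv ℝ φ x x ≤ ∫ x, ‖gradient φ x‖ * ‖x‖ := by
    have hc := hφ.contDiff_one.continuous_fderiv one_ne_zero
    rw [← integral_neg]
    refine integral_mono ?_ ?_ fun x => ?_
    · refine ((hc.clm_apply continuous_id).integrable_of_hasCompactSupport ?_).neg
      refine (hφ.2.1.fderiv (𝕜 := ℝ)).mono fun x hx h0 => hx ?_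
      simp only [id]
      rw [h0]
      rfl
    · exact (hφ.continuous_gradient.norm.mul continuous_norm).integrable_of_hasCompactSupport
        (hasCompactSupport_gradient hφ.2.1).norm.mul_right
    · rw [norm_gradient]
      exact (neg_le_abs _).trans ((fderiv ℝ φ x).le_opNorm x)
  rw [h1, neg_neg] at h3
  rw [div_mul_eq_mul_div, le_div_iff₀' hD']
  exact h3.trans h2

/-- If the gauge has small slope somewhere then the bound for `torsionRatio` is not sharp. -/
theorem IsGaugeAt.torsionRatio_lt (hD : 0 < D) {q : ℝ} (hpq : p.HolderConjugate q)
    (hΩ : Ω ∈ convexDomains D) (hR : inradius Ω = 1) {x₀ : E D} {J : E D → ℝ}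
    (h : IsGaugeAt Ω x₀ J) (hJ : LipschitzWith 1 J) {U : Set (E D)} (hU : IsOpen U)
    (hUne : U.Nonempty) (hUΩ : U ⊆ Ω) (hJU : ∀ x ∈ U, 0 < J x ∧ ‖fderiv ℝ J x‖ ≤ 1 / 2) :
    torsionRatio p q Ω < D := by
  have hD' : (0 : ℝ) < D := by exact_mod_cast hD
  have hp0 := hpq.pos
  have hq0 := hpq.symm.pos
  have hV := volume_pos hΩ
  have hτ := torsionalRigidity_rpow_pos hD hpq.lt hΩ
  obtain ⟨-, ho, hb, hcv⟩ := hΩ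
  have h1 := h.volume_le hD hpq.lt ho hb hJ hpq
  set A := ∫ x in Ω, J x ^ q * ‖fderiv ℝ J x‖ ^ p with hA
  set W := volume.real Ω * (D / (D + q)) with hW
  have hW0 : 0 < W := by positivity
  have hA0 : 0 ≤ A := h.integral_fderiv_nonneg q p
  have i1 := h.integrableOn_rpow_mul ho hb hJ hq0.le hp0.le
  have i2 : Integrable (fun x => J x ^ q) (volume.restrict Ω) := by
    simpa using h.integrableOn_rpow_mul ho hb hJ hq0.le le_rfl
  have hslope : ∀ x, ‖fderiv ℝ J x‖ ^ p ≤ 1 := fun x =>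
    Real.rpow_le_one (norm_nonneg _) (by simpa using norm_fderiv_le_of_lipschitz ℝ hJ) hp0.le
  -- The difference is `∫ J^q (1 - |∇J|^p)`, whose integrand is nonnegative and strictly positive on
  -- the nonempty open set `U`.
  have hAW : A < W := by
    rw [← sub_pos, hW, ← h.integral_rpow ho hb hJ.continuous hq0, ← integral_sub i2 i1]
    have hnn : ∀ x, 0 ≤ J x ^ q - J x ^ q * ‖fderiv ℝ J x‖ ^ p := fun x => by
      have := mul_le_mul_of_nonneg_left (hslope x) (Real.rpow_nonneg (h.nonneg x) q)
      linarith
    rw [integral_pos_iff_support_of_nonneg hnn (i2.sub i1)]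
    refine lt_of_lt_of_le (hU.measure_pos volume hUne) ?_
    rw [← Measure.restrict_eq_self volume hUΩ]
    refine measure_mono fun x hx => ?_
    obtain ⟨h2, h3⟩ := hJU x hx
    have h4 : ‖fderiv ℝ J x‖ ^ p < 1 :=
      Real.rpow_lt_one (norm_nonneg _) (by linarith) hp0
    have h5 : 0 < J x ^ q := by positivity
    rw [Function.mem_support]
    nlinarith
  have h2 : A ^ (1 / p) < W ^ (1 / p) := Real.rpow_lt_rpow hA0 hAW (by positivity)
  have h3 : W ^ (1 / q) / D < torsionalRigidity p Ω ^ (1 - 1 / p) := by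
    have h4 : volume.real Ω * (q / (D + q)) = q * (W / D) := by rw [hW]; field_simp
    have h5 : W = W ^ (1 / q) * W ^ (1 / p) := by
      have := hpq.inv_add_inv_eq_one
      rw [← Real.rpow_add hW0, one_div, one_div, add_comm, this, Real.rpow_one]
    have h6 : 0 < W ^ (1 / p) := by positivity
    refine lt_of_mul_lt_mul_right ?_ h6.le
    calc W ^ (1 / q) / D * W ^ (1 / p) = W / D := by
          conv_rhs => rw [h5]
          ring
      _ ≤ torsionalRigidity p Ω ^ (1 - 1 / p) * A ^ (1 / p) := by
          refine le_of_mul_le_mul_left ?_ hq0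
          rw [h4] at h1
          linarith
      _ < _ := by gcongr
  rw [torsionRatio, hR, one_mul, div_lt_iff₀ hτ, ← div_lt_iff₀' hD']
  exact h3

/-- The ball of radius two truncated to the slab `|x i| < 1`. -/
def truncatedBall (i : Fin D) : Set (E D) := {x | max |x i| (‖x‖ / 2) < 1}

theorem continuous_truncatedGauge (i : Fin D) : Continuous fun x : E D => max |x i| (‖x‖ / 2) := by
  fun_prop

theorem isGaugeAt_truncatedBall (i : Fin D) :
    IsGaugeAt (truncatedBall i) 0 fun x => max |x i| (‖x‖ / 2) where
  nonneg x := le_max_of_le_left (abs_nonneg _)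
  lt_one_iff x := Iff.rfl
  map_smul t ht v := by
    rw [mul_max_of_nonneg _ _ ht.le]
    simp [norm_smul, abs_mul, abs_of_pos ht, mul_div_assoc]

theorem truncatedBall_mem_convexDomains (i : Fin D) : truncatedBall i ∈ convexDomains D := by
  refine ⟨⟨0, by simp [truncatedBall]⟩, isOpen_lt (continuous_truncatedGauge i) continuous_const,
    ?_, ?_⟩
  · refine (Metric.isBounded_ball (x := (0 : E D)) (r := 2)).subset fun x hx => ?_
    have := (max_lt_iff.1 (show max |x i| (‖x‖ / 2) < 1 from hx)).2
    rw [mem_ball_zero_iff]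
    linarith
  · have h : truncatedBall i = {x : E D | -1 < x i} ∩ {x | x i < 1} ∩ Metric.ball 0 2 := by
      ext x
      simp only [truncatedBall, Set.mem_ofPred_eq, max_lt_iff, abs_lt, Set.mem_inter_iff,
        mem_ball_zero_iff, div_lt_one (two_pos : (0 : ℝ) < 2)]
    have hl : IsLinearMap ℝ fun x : E D => x i := ⟨fun _ _ => rfl, fun _ _ => rfl⟩
    rw [h]
    exact ((convex_halfSpace_gt hl _).inter (convex_halfSpace_lt hl _)).inter (convex_ball _ _)

theorem lipschitzWith_truncatedGauge (i : Fin D) :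
    LipschitzWith 1 fun x : E D => max |x i| (‖x‖ / 2) := by
  have h1 : LipschitzWith 1 fun x : E D => |x i| := by
    refine LipschitzWith.of_dist_le_mul fun x y => ?_
    rw [NNReal.coe_one, one_mul, Real.dist_eq, dist_eq_norm]
    exact (abs_abs_sub_abs_le _ _).trans (abs_apply_le_norm (x - y) i)
  have h2 : LipschitzWith 1 fun x : E D => ‖x‖ / 2 := by
    refine LipschitzWith.of_dist_le_mul fun x y => ?_
    rw [NNReal.coe_one, one_mul, Real.dist_eq, dist_eq_norm, ← sub_div, abs_div, abs_two]
    have := abs_norm_sub_norm_le x y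
    linarith [norm_nonneg (x - y)]
  simpa using h1.max h2

/-- Where `|x i| < ‖x‖ / 2` the gauge is `‖x‖ / 2`, of slope at most `1/2`. A second axis `j` is
needed for this region to be nonempty: it contains `e_j`. -/
theorem torsionRatio_truncatedBall_lt {q : ℝ} (hpq : p.HolderConjugate q) {i j : Fin D}
    (hij : j ≠ i) : torsionRatio p q (truncatedBall i) < D := by
  have hΩ := truncatedBall_mem_convexDomains i
  have hR : inradius (truncatedBall i) = 1 := by
    refine inradius_eq_one (i := i) hΩ (fun x hx => ?_) fun x hx => (max_lt_iff.1 hx).1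
    rw [mem_ball_zero_iff] at hx
    exact max_lt ((abs_apply_le_norm x i).trans_lt hx) (by linarith)
  refine (isGaugeAt_truncatedBall i).torsionRatio_lt i.pos hpq hΩ hR
    (lipschitzWith_truncatedGauge i) (U := {x | |x i| < ‖x‖ / 2} ∩ {x | ‖x‖ < 2}) ?_ ?_ ?_ ?_
  · exact (isOpen_lt (by fun_prop) (by fun_prop)).inter (isOpen_lt (by fun_prop) (by fun_prop))
  · refine ⟨EuclideanSpace.single j 1, ?_, ?_⟩
    · simp [hij.symm]
    · simp
  · rintro x ⟨h1, h2⟩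
    simp only [Set.mem_ofPred_eq] at h1 h2
    have h3 : max |x i| (‖x‖ / 2) < 1 := max_lt (by linarith) (by linarith)
    exact h3
  · rintro x ⟨h1, h2⟩
    simp only [Set.mem_ofPred_eq] at h1 h2
    have h3 : 0 < ‖x‖ / 2 := (abs_nonneg _).trans_lt h1
    refine ⟨lt_max_of_lt_right h3, ?_⟩
    have h4 : (fun y : E D => max |y i| (‖y‖ / 2)) =ᶠ[𝓝 x] fun y => ‖y‖ / 2 := by
      have : IsOpen {y : E D | |y i| < ‖y‖ / 2} := isOpen_lt (by fun_prop) (by fun_prop)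
      filter_upwards [this.mem_nhds h1] with y hy
      exact max_eq_right (le_of_lt hy)
    rw [h4.fderiv_eq]
    have h5 : LipschitzWith (1 / 2) fun y : E D => ‖y‖ / 2 := by
      refine LipschitzWith.of_dist_le_mul fun x y => ?_
      rw [Real.dist_eq, dist_eq_norm, ← sub_div, abs_div, abs_two]
      have := abs_norm_sub_norm_le x y
      push_cast
      linarith
    simpa using norm_fderiv_le_of_lipschitz ℝ h5 (x₀ := x)

/-! ### Dilations -/

theorem smul_mem_convexDomains {t : ℝ} (ht : 0 < t) (hΩ : Ω ∈ convexDomains D) :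
    t • Ω ∈ convexDomains D :=
  ⟨hΩ.1.smul_set, hΩ.2.1.smul₀ ht.ne', hΩ.2.2.1.smul₀ t, hΩ.2.2.2.smul t⟩

/-- One inequality suffices: applied to `t • Ω` and `t⁻¹` it becomes its own converse. The
invariance of `torsionRatio` is obtained in the same way. -/
theorem mul_inradius_le (hD : 0 < D) {t : ℝ} (ht : 0 < t) (hΩ : Ω ∈ convexDomains D) :
    t * inradius Ω ≤ inradius (t • Ω) := by
  obtain ⟨-, -, x₀, hx₀⟩ := exists_incenter hD hΩ
  have hΩ' := smul_mem_convexDomains ht hΩ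
  obtain ⟨-, hR, -⟩ := exists_incenter hD hΩ'
  refine (le_infDist_of_ball_subset (x := t • x₀) (compl_nonempty hD hΩ'.2.2.1) ?_).trans (hR _)
  have := _root_.smul_ball ht.ne' x₀ (inradius Ω)
  rw [Real.norm_of_nonneg ht.le] at this
  rw [← this]
  exact Set.smul_set_mono hx₀

theorem inradius_smul (hD : 0 < D) {t : ℝ} (ht : 0 < t) (hΩ : Ω ∈ convexDomains D) :
    inradius (t • Ω) = t * inradius Ω := by
  refine le_antisymm ?_ (mul_inradius_le hD ht hΩ)
  have := mul_inradius_le hD (inv_pos.2 ht) (smul_mem_convexDomains ht hΩ)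
  rwa [inv_smul_smul₀ ht.ne', inv_mul_le_iff₀ ht] at this

theorem volume_smul {t : ℝ} (ht : 0 < t) : volume.real (t • Ω) = t ^ D * volume.real Ω := by
  rw [measureReal_def, Measure.addHaar_smul, ENNReal.toReal_mul,
    ENNReal.toReal_ofReal (abs_nonneg _), finrank_euclideanSpace_fin,
    abs_of_nonneg (by positivity), measureReal_def]

theorem IsTestFunction.comp_smul {t : ℝ} (ht : 0 < t) {φ : E D → ℝ}
    (hφ : IsTestFunction (t • Ω) φ) : IsTestFunction Ω fun x => φ (t • x) := by
  refine ⟨hφ.1.comp (contDiff_const_smul t), hφ.2.1.comp_smul ht.ne', fun x hx => ?_⟩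
  have h1 : t • x ∈ tsupport φ := tsupport_comp_subset_preimage φ (continuous_const_smul t) hx
  exact (Set.smul_mem_smul_set_iff₀ ht.ne' _ _).1 (hφ.2.2 h1)

theorem gradient_comp_smul {t : ℝ} (φ : E D → ℝ) (x : E D) :
    ‖gradient (fun y => φ (t • y)) x‖ = |t| * ‖gradient φ (t • x)‖ := by
  rw [norm_gradient, norm_gradient]
  have : fderiv ℝ (fun y => φ (t • y)) x = t • fderiv ℝ φ (t • x) := fderiv_comp_smul t
  rw [this, norm_smul, Real.norm_eq_abs]

/-- A change of variables in the torsion inequality: a test function on `t • Ω` pulls back to one on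
`Ω`. -/
theorem torsionalRigidity_smul_le (hD : 0 < D) (hp : 1 < p) {t : ℝ} (ht : 0 < t)
    (hΩ : Ω ∈ convexDomains D) :
    torsionalRigidity p (t • Ω) ^ (1 - 1 / p) ≤
      t * (t ^ D) ^ (1 - 1 / p) * torsionalRigidity p Ω ^ (1 - 1 / p) := by
  have hp0 : 0 < p := by linarith
  have hτ := torsionalRigidity_rpow_pos hD hp hΩ
  refine torsionalRigidity_rpow_le hD hp (smul_mem_convexDomains ht hΩ).2.2.1 (by positivity)
    fun φ hφ => ?_
  have hψ := hφ.comp_smul ht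
  have key := integral_le_torsionalRigidity hD hp hΩ.2.2.1 hψ
  have h1 : ∫ x, φ (t • x) = (t ^ D)⁻¹ * ∫ x, φ x := by
    rw [Measure.integral_comp_smul, finrank_euclideanSpace_fin, abs_of_pos (by positivity),
      smul_eq_mul]
  have h2 : ∫ x, ‖gradient (fun y => φ (t • y)) x‖ ^ p =
      t ^ p * ((t ^ D)⁻¹ * ∫ x, ‖gradient φ x‖ ^ p) := by
    simp only [gradient_comp_smul, abs_of_pos ht,
      Real.mul_rpow ht.le (norm_nonneg _)]
    rw [integral_const_mul, Measure.integral_comp_smul volume (fun x => ‖gradient φ x‖ ^ p),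
      finrank_euclideanSpace_fin, abs_of_pos (by positivity), smul_eq_mul]
  have hI : 0 ≤ ∫ x, ‖gradient φ x‖ ^ p := integral_nonneg fun x => by positivity
  rw [h1, h2, Real.mul_rpow (by positivity) (by positivity), ← Real.rpow_mul ht.le,
    mul_one_div_cancel hp0.ne', Real.rpow_one, Real.mul_rpow (by positivity) hI,
    inv_mul_le_iff₀ (by positivity)] at key
  refine key.trans (le_of_eq ?_)
  rw [Real.rpow_sub (by positivity : 0 < t ^ D), Real.rpow_one, Real.inv_rpow (by positivity)]
  ring

theorem torsionRatio_le_smul (hD : 0 < D) {q : ℝ} (hpq : p.HolderConjugate q) {t : ℝ} (ht : 0 < t)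
    (hΩ : Ω ∈ convexDomains D) : torsionRatio p q Ω ≤ torsionRatio p q (t • Ω) := by
  have hq0 := hpq.symm.pos
  have hΩ' := smul_mem_convexDomains ht hΩ
  have hτ := torsionalRigidity_rpow_pos hD hpq.lt hΩ
  have hτ' := torsionalRigidity_rpow_pos hD hpq.lt hΩ'
  have hV := volume_pos hΩ
  have hR := (exists_incenter hD hΩ).1
  have he : 1 - 1 / p = 1 / q := by
    have := hpq.inv_add_inv_eq_one
    rw [one_div, one_div]
    linarith
  have h1 := torsionalRigidity_smul_le hD hpq.lt ht hΩ
  unfold torsionRatio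
  have hW : (t ^ D * (volume.real Ω * (D / (D + q)))) ^ (1 / q) =
      (t ^ D) ^ (1 / q) * (volume.real Ω * (D / (D + q))) ^ (1 / q) :=
    Real.mul_rpow (by positivity) (by positivity)
  rw [inradius_smul hD ht hΩ, volume_smul ht, mul_assoc (t ^ D), hW, div_le_div_iff₀ hτ hτ']
  rw [he] at h1 ⊢
  calc _ ≤ inradius Ω * (volume.real Ω * (D / (D + q))) ^ (1 / q) *
        (t * (t ^ D) ^ (1 / q) * torsionalRigidity p Ω ^ (1 / q)) := by gcongr
    _ = _ := by ring

theorem torsionRatio_smul (hD : 0 < D) {q : ℝ} (hpq : p.HolderConjugate q) {t : ℝ} (ht : 0 < t)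
    (hΩ : Ω ∈ convexDomains D) : torsionRatio p q (t • Ω) = torsionRatio p q Ω := by
  refine le_antisymm ?_ (torsionRatio_le_smul hD hpq ht hΩ)
  have := torsionRatio_le_smul hD hpq (inv_pos.2 ht) (smul_mem_convexDomains ht hΩ)
  rwa [inv_smul_smul₀ ht.ne'] at this

/-! ### The quantity `Q` -/

theorem normTorsion_pos (hD : 0 < D) (hp : 1 < p) (hΩ : Ω ∈ convexDomains D) :
    0 < normTorsion p Ω := by
  have hτ := torsionalRigidity_rpow_pos hD hp hΩ
  have hT : 0 < torsionalRigidity p Ω := by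
    rcases (torsionalRigidity_nonneg hD hp hΩ.2.2.1).eq_or_lt with h | h
    · have h1p : 1 / p < 1 := by rw [div_lt_one (by linarith)]; exact hp
      rw [← h, Real.zero_rpow (by linarith)] at hτ
      exact absurd hτ (lt_irrefl _)
    · exact h
  have hV := volume_pos hΩ
  unfold normTorsion
  positivity

theorem normTorsion_eq (hD : 0 < D) (hp : 1 < p) (hΩ : Ω ∈ convexDomains D) :
    normTorsion p Ω =
      ((2 * p - 1) / (p - 1)) ^ (p - 1) * (Q p Ω / inradius Ω) ^ p := by
  have hp0 : 0 < p := by linarith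
  have hN := normTorsion_pos hD hp hΩ
  have hR := (exists_incenter hD hΩ).1
  have hc : 0 < ((2 * p - 1) / (p - 1)) ^ (p - 1) :=
    Real.rpow_pos_of_pos (div_pos (by linarith) (by linarith)) _
  unfold Q
  rw [Real.div_rpow (by positivity) hR.le, ← Real.rpow_mul (by positivity),
    one_div_mul_cancel hp0.ne', Real.rpow_one]
  field_simp

/-- Since `p - 1 = p / q`, `T(p;Ω)` is the `p`-th power of `(|Ω| / T)^(1/q)`; what remains depends
on `D` and `p` only. -/
theorem exists_Q_eq_mul_torsionRatio (hD : 0 < D) {q : ℝ} (hpq : p.HolderConjugate q) :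
    ∃ k, 0 < k ∧ ∀ Ω ∈ convexDomains D, Q p Ω = k * torsionRatio p q Ω := by
  have hp0 := hpq.pos
  have hp := hpq.lt
  have hq0 := hpq.symm.pos
  have hD' : (0 : ℝ) < D := by exact_mod_cast hD
  have he : 1 - 1 / p = 1 / q := by
    have := hpq.inv_add_inv_eq_one
    rw [one_div, one_div]
    linarith
  have he2 : p - 1 = 1 / q * p := by rw [← he]; field_simp
  set c := ((2 * p - 1) / (p - 1)) ^ (p - 1) with hcdef
  have hc : 0 < c := Real.rpow_pos_of_pos (div_pos (by linarith) (by linarith)) _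
  refine ⟨((D / (D + q) : ℝ) ^ (1 / q))⁻¹ / c ^ (1 / p), by positivity, fun Ω hΩ => ?_⟩
  have hV := volume_pos hΩ
  have hR := (exists_incenter hD hΩ).1
  have hτ := torsionalRigidity_rpow_pos hD hp hΩ
  have hT := torsionalRigidity_nonneg hD hp hΩ.2.2.1
  have hN : normTorsion p Ω =
      (volume.real Ω ^ (1 / q) / torsionalRigidity p Ω ^ (1 - 1 / p)) ^ p := by
    rw [Real.div_rpow (by positivity) hτ.le, ← Real.rpow_mul hV.le, ← Real.rpow_mul hT, he, ← he2,
      normTorsion, div_eq_mul_inv, ← Real.rpow_neg hT, neg_sub]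
  rw [Q, hN, ← hcdef, ← Real.mul_rpow (by positivity) hR.le,
    Real.div_rpow (by positivity) hc.le, ← Real.rpow_mul (by positivity),
    mul_one_div_cancel hp0.ne', Real.rpow_one, torsionRatio,
    Real.mul_rpow hV.le (by positivity)]
  field_simp

/-- A dilation changes the inradius at will and leaves `Q` unchanged, so fixing the inradius does
not restrict the values of `Q`. -/
theorem exists_mem_convexDomainsOfInradius (hD : 0 < D) (hp : 1 < p) {r : ℝ} (hr : 0 < r)
    (hΩ : Ω ∈ convexDomains D) :
    ∃ Ω' ∈ convexDomainsOfInradius D r, Q p Ω' = Q p Ω := by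
  have hpq := Real.HolderConjugate.conjExponent hp
  obtain ⟨k, -, hk⟩ := exists_Q_eq_mul_torsionRatio hD hpq
  have hR := (exists_incenter hD hΩ).1
  have ht : 0 < r / inradius Ω := by positivity
  have hΩ' := smul_mem_convexDomains ht hΩ
  refine ⟨(r / inradius Ω) • Ω, ⟨hΩ', ?_⟩, ?_⟩
  · rw [inradius_smul hD ht hΩ, div_mul_cancel₀ _ hR.ne']
  · rw [hk _ hΩ, hk _ hΩ', torsionRatio_smul hD hpq ht hΩ]

theorem Q_pos (hD : 0 < D) (hp : 1 < p) (hΩ : Ω ∈ convexDomains D) : 0 < Q p Ω := by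
  have hN := normTorsion_pos hD hp hΩ
  have hR := (exists_incenter hD hΩ).1
  have hc : 0 < ((2 * p - 1) / (p - 1)) ^ (p - 1) :=
    Real.rpow_pos_of_pos (div_pos (by linarith) (by linarith)) _
  unfold Q
  positivity

/-- Comparison of normalized torsions through the quantities `Q`. -/
theorem normTorsion_le_iff (hD : 0 < D) (hp : 1 < p) {a b : ℝ} (ha : 0 < a) (hb : 0 < b)
    {Ωa Ωb : Set (E D)} (hΩa : Ωa ∈ convexDomainsOfInradius D a)
    (hΩb : Ωb ∈ convexDomainsOfInradius D b) :
    normTorsion p Ωb ≤ normTorsion p Ωa ↔ Q p Ωb * a ≤ Q p Ωa * b := by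
  have hp0 : 0 < p := by linarith
  have hc : 0 < ((2 * p - 1) / (p - 1)) ^ (p - 1) :=
    Real.rpow_pos_of_pos (div_pos (by linarith) (by linarith)) _
  have hQa := Q_pos hD hp hΩa.1
  have hQb := Q_pos hD hp hΩb.1
  rw [normTorsion_eq hD hp hΩa.1, normTorsion_eq hD hp hΩb.1, hΩa.2, hΩb.2,
    mul_le_mul_iff_right₀ hc, Real.rpow_le_rpow_iff (by positivity) (by positivity) hp0,
    div_le_div_iff₀ hb ha]

end

end PTorsion

end

/-! ### The comparison theorem -/

open PTorsion in
theorem mainTheorem1 (D : ℕ) (hD : 2 ≤ D) (p : ℝ) (hp : 1 < p) :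
    BddAbove (PTorsion.Q p '' PTorsion.convexDomains D) ∧
    1 / (D : ℝ) ≤ PTorsion.gammaConst D p ∧ PTorsion.gammaConst D p < 1 ∧
    ∀ a b : ℝ, 0 < a → a < b →
      ((∀ Ωa ∈ PTorsion.convexDomainsOfInradius D a,
          ∀ Ωb ∈ PTorsion.convexDomainsOfInradius D b,
            PTorsion.normTorsion p Ωb ≤ PTorsion.normTorsion p Ωa) ↔
        PTorsion.gammaConst D p * b ≥ a) ∧
      (PTorsion.gammaConst D p * b > a →
        ∀ Ωa ∈ PTorsion.convexDomainsOfInradius D a,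
          ∀ Ωb ∈ PTorsion.convexDomainsOfInradius D b,
            PTorsion.normTorsion p Ωb < PTorsion.normTorsion p Ωa) ∧
      (PTorsion.gammaConst D p * b = a →
        ∃ U V : ℕ → Set (PTorsion.E D),
          (∀ n, U n ∈ PTorsion.convexDomainsOfInradius D a) ∧
          (∀ n, V n ∈ PTorsion.convexDomainsOfInradius D b) ∧
          ∃ l : ℝ,
            Tendsto (fun n => PTorsion.normTorsion p (V n)) atTop (𝓝 l) ∧
            Tendsto (fun n => PTorsion.normTorsion p (U n)) atTop (𝓝 l)) := by
  have hD0 : 0 < D := by omega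
  have hD' : (0 : ℝ) < D := by exact_mod_cast hD0
  have hp0 : 0 < p := by linarith
  have hpq := Real.HolderConjugate.conjExponent hp
  obtain ⟨k, hk, hQ⟩ := exists_Q_eq_mul_torsionRatio hD0 hpq
  set S := Q p '' convexDomains D with hS
  have hSne : S.Nonempty := ⟨_, _, ball_mem_convexDomains, rfl⟩
  have hle : ∀ y ∈ S, y ≤ k * D := by
    rintro _ ⟨Ω, hΩ, rfl⟩
    rw [hQ Ω hΩ]
    exact mul_le_mul_of_nonneg_left (torsionRatio_mem_Icc hD0 hpq hΩ).2 hk.le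
  have hge : ∀ y ∈ S, k ≤ y := by
    rintro _ ⟨Ω, hΩ, rfl⟩
    rw [hQ Ω hΩ]
    exact le_mul_of_one_le_right hk.le (torsionRatio_mem_Icc hD0 hpq hΩ).1
  have hbdd : BddAbove S := ⟨_, hle⟩
  have hbdd' : BddBelow S := ⟨_, hge⟩
  have hsup : sSup S ≤ k * D := csSup_le hSne hle
  have hinf : k ≤ sInf S := le_csInf hSne hge
  have hinf0 : 0 < sInf S := hk.trans_le hinf
  have hlt : sInf S < sSup S := by
    let i : Fin D := ⟨0, hD0⟩
    let j : Fin D := ⟨1, by omega⟩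
    have hij : j ≠ i := by simp [i, j]
    have h1 := truncatedBall_mem_convexDomains i
    calc sInf S ≤ Q p (truncatedBall i) := csInf_le hbdd' ⟨_, h1, rfl⟩
      _ < Q p (Metric.ball (0 : E D) 1) := by
        rw [hQ _ h1, hQ _ ball_mem_convexDomains]
        exact mul_lt_mul_of_pos_left ((torsionRatio_truncatedBall_lt hpq hij).trans_le
          (le_torsionRatio_ball hD0 hpq)) hk
      _ ≤ sSup S := le_csSup hbdd ⟨_, ball_mem_convexDomains, rfl⟩
  have hsup0 : 0 < sSup S := hinf0.trans hlt
  have hγ : gammaConst D p = sInf S / sSup S := rfl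
  refine ⟨hbdd, ?_, ?_, fun a b ha hab => ?_⟩
  · rw [hγ, div_le_div_iff₀ hD' hsup0, one_mul]
    exact hsup.trans (mul_le_mul_of_nonneg_right hinf hD'.le)
  · rw [hγ, div_lt_one hsup0]
    exact hlt
  have hb : 0 < b := ha.trans hab
  have hγb : gammaConst D p * b = sInf S * b / sSup S := by rw [hγ]; ring
  refine ⟨⟨fun h => ?_, fun h Ωa hΩa Ωb hΩb => ?_⟩, fun h Ωa hΩa Ωb hΩb => ?_, fun h => ?_⟩
  -- The two values may be chosen independently, after rescaling one domain to inradius `b` and the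
  -- other to inradius `a`. Taking the supremum over `y` and the infimum over `z` gives `sSup S * a
  -- ≤ sInf S * b`.
  · have key : ∀ y ∈ S, ∀ z ∈ S, y * a ≤ z * b := by
      rintro _ ⟨Ω₁, h₁, rfl⟩ _ ⟨Ω₂, h₂, rfl⟩
      obtain ⟨Ωb, hΩb, hb'⟩ := exists_mem_convexDomainsOfInradius (p := p) hD0 hp hb h₁
      obtain ⟨Ωa, hΩa, ha'⟩ := exists_mem_convexDomainsOfInradius (p := p) hD0 hp ha h₂
      rw [← hb', ← ha']
      exact (normTorsion_le_iff hD0 hp ha hb hΩa hΩb).1 (h Ωa hΩa Ωb hΩb)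
    rw [hγb, ge_iff_le, le_div_iff₀ hsup0, mul_comm, ← le_div_iff₀ ha]
    refine csSup_le hSne fun y hy => ?_
    rw [le_div_iff₀ ha, ← div_le_iff₀ hb]
    exact le_csInf hSne fun z hz => (div_le_iff₀ hb).2 (key y hy z hz)
  · rw [normTorsion_le_iff hD0 hp ha hb hΩa hΩb]
    rw [hγb, ge_iff_le, le_div_iff₀ hsup0] at h
    have h1 : Q p Ωb ≤ sSup S := le_csSup hbdd ⟨_, hΩb.1, rfl⟩
    have h2 : sInf S ≤ Q p Ωa := csInf_le hbdd' ⟨_, hΩa.1, rfl⟩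
    nlinarith
  · rw [← not_le, normTorsion_le_iff hD0 hp hb ha hΩb hΩa, not_le]
    rw [hγb, gt_iff_lt, lt_div_iff₀ hsup0] at h
    have h1 : Q p Ωb ≤ sSup S := le_csSup hbdd ⟨_, hΩb.1, rfl⟩
    have h2 : sInf S ≤ Q p Ωa := csInf_le hbdd' ⟨_, hΩa.1, rfl⟩
    nlinarith
  -- A maximizing sequence for `Q` rescaled to inradius `b` and a minimizing one rescaled to
  -- inradius `a`. Their limits agree because `γ b = a` says `sSup S / b = sInf S / a`.
  · obtain ⟨y, -, hy, hyS⟩ := exists_seq_tendsto_sSup hSne hbdd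
    obtain ⟨z, -, hz, hzS⟩ := exists_seq_tendsto_sInf hSne hbdd'
    have hV : ∀ n, ∃ Ω ∈ convexDomainsOfInradius D b, Q p Ω = y n := by
      intro n
      obtain ⟨Ω, hΩ, hn⟩ := hyS n
      rw [← hn]
      exact exists_mem_convexDomainsOfInradius hD0 hp hb hΩ
    have hU : ∀ n, ∃ Ω ∈ convexDomainsOfInradius D a, Q p Ω = z n := by
      intro n
      obtain ⟨Ω, hΩ, hn⟩ := hzS n
      rw [← hn]
      exact exists_mem_convexDomainsOfInradius hD0 hp ha hΩ
    choose V hVb hVy using hV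
    choose U hUa hUz using hU
    refine ⟨U, V, hUa, hVb, ((2 * p - 1) / (p - 1)) ^ (p - 1) * (sSup S / b) ^ p, ?_, ?_⟩
    · have := ((hy.div_const b).rpow_const (p := p) (Or.inr hp0.le)).const_mul
        (((2 * p - 1) / (p - 1)) ^ (p - 1))
      refine this.congr fun n => ?_
      rw [normTorsion_eq hD0 hp (hVb n).1, hVy, (hVb n).2]
    · have h1 : sSup S / b = sInf S / a := by
        rw [← h, hγb]
        field_simp
      rw [h1]
      have := ((hz.div_const a).rpow_const (p := p) (Or.inr hp0.le)).const_mul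
        (((2 * p - 1) / (p - 1)) ^ (p - 1))
      refine this.congr fun n => ?_
      rw [normTorsion_eq hD0 hp (hUa n).1, hUz, (hUa n).2]
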